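/- Computations are performed on a deterministic word RAM with unit-cost instructions. The strong exponential time hypothesis (SETH) states that for every $\delta>0$ there is an integer $k\ge 3$ such that no algorithm, using words of $O(n+\log M)$ bits, decides the satisfiability of every CNF formula with $n$ variables and $M$ clauses of at most $k$ literals each in time $2^{(1-\delta)n}\cdot\mathrm{poly}(n+M)$. In incremental (decremental) maximum $s$-$t$ flow, a simple directed graph on $n$ nodes with positive integer edge capacities and two distinct nodes $s,t$ is given; it starts without edges (with an arbitrary edge set) and undergoes an online sequence of operations, each of which is either the insertion of a new edge with its capacity (the deletion of an edge) or a query, which has to be answered by the maximum value of an $s$-$t$ flow in the current graph. Let $m$ be the largest number of edges present at any time. An algorithm, using words of $O(\log S)$ bits, where $S$ is the sum of the number of nodes, the number of starting edges, the number of operations and all capacities, has amortized time $O(m^{1-\varepsilon})$ per operation if its total time, including all initialization, on every admissible input is at most $C\,(n+m_0+q)\,(m+1)^{1-\varepsilon}$ for a constant $C$, where $m_0$ is the number of edges of the starting graph and $q$ the number of updates and queries. **Theorem.** Assume SETH. Then for every $\varepsilon>0$ and all integers $K\ge 1$, $p\ge 0$ there is no algorithm for incremental maximum $s$-$t$ flow,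 and none for decremental maximum $s$-$t$ flow, on weighted directed graphs with $n$ nodes and at all times at most $K\,n\,\lfloor\log_2 n\rfloor^{p}$ (that is, $\tilde O(n)$) edges, that has amortized time $O(m^{1-\varepsilon})$ per operation. -/

import Mathlib

/-! ### Word RAM

Programs are structured programs over registers and finitely many random access memories
("arrays"), both holding natural numbers. The computation is that of a word RAM with `w`-bit words:
every value that is computed has to be smaller than `2 ^ w`, otherwise the execution gets stuck.
Every elementary instruction and every test of a branch or a loop costs one step. -/

namespace WordRAM

/-- The arithmetic, bitwise and comparison instructions. -/
inductive BinOp where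
  | add | sub | mul | div | mod | and | or | xor | shl | shr | lt | eq

/-- Meaning of the binary instructions (`sub` is truncated, comparisons return `0` or `1`). -/
def BinOp.eval : BinOp → ℕ → ℕ → ℕ
  | .add, a, b => a + b
  | .sub, a, b => a - b
  | .mul, a, b => a * b
  | .div, a, b => a / b
  | .mod, a, b => a % b
  | .and, a, b => a &&& b
  | .or, a, b => a ||| b
  | .xor, a, b => a ^^^ b
  | .shl, a, b => a <<< b
  | .shr, a, b => a >>> b
  | .lt, a, b => if a < b then 1 else 0
  | .eq, a, b => if a = b then 1 else 0

/-- Programs. Registers and arrays are named by natural numbers. -/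
inductive Prog where
  /-- do nothing -/
  | skip
  /-- `r := v` for a constant `v` -/
  | const (r v : ℕ)
  /-- `r := f a b` for registers `r`, `a`, `b` -/
  | bin (f : BinOp) (r a b : ℕ)
  /-- `r := M[i]` for an array `M` and registers `r`, `i` -/
  | load (r M i : ℕ)
  /-- `M[i] := r` for an array `M` and registers `r`, `i` -/
  | store (M i r : ℕ)
  /-- sequential composition -/
  | seq (p q : Prog)
  /-- if register `r` is nonzero then `p` else `q` -/
  | branch (r : ℕ) (p q : Prog)
  /-- while register `r` is nonzero do `p` -/
  | loop (r : ℕ) (p : Prog)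

/-- Memory contents: `reg r` is the content of register `r`, `mem M i` is cell `i` of array `M`. -/
structure State where
  reg : ℕ → ℕ
  mem : ℕ → ℕ → ℕ

/-- Overwrite a register. -/
def State.setReg (σ : State) (r v : ℕ) : State where
  reg := Function.update σ.reg r v
  mem := σ.mem

/-- Overwrite an array cell. -/
def State.setMem (σ : State) (M i v : ℕ) : State where
  reg := σ.reg
  mem := Function.update σ.mem M (Function.update (σ.mem M) i v)

/-- `Exec w p σ σ' T`: with `w`-bit words, the program `p` started in `σ` halts in `σ'` after
exactly `T` steps. -/
inductive Exec (w : ℕ) : Prog → State → State → ℕ → Prop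
  | skip (σ : State) : Exec w .skip σ σ 1
  | const (σ : State) (r v : ℕ) (h : v < 2 ^ w) : Exec w (.const r v) σ (σ.setReg r v) 1
  | bin (σ : State) (f : BinOp) (r a b : ℕ) (h : f.eval (σ.reg a) (σ.reg b) < 2 ^ w) :
      Exec w (.bin f r a b) σ (σ.setReg r (f.eval (σ.reg a) (σ.reg b))) 1
  | load (σ : State) (r M i : ℕ) :
      Exec w (.load r M i) σ (σ.setReg r (σ.mem M (σ.reg i))) 1
  | store (σ : State) (M i r : ℕ) :
      Exec w (.store M i r) σ (σ.setMem M (σ.reg i) (σ.reg r)) 1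
  | seq {p q : Prog} {σ σ' σ'' : State} {T T' : ℕ} (hp : Exec w p σ σ' T)
      (hq : Exec w q σ' σ'' T') : Exec w (.seq p q) σ σ'' (T + T')
  | branch_true {r : ℕ} {p q : Prog} {σ σ' : State} {T : ℕ} (hr : σ.reg r ≠ 0)
      (hp : Exec w p σ σ' T) : Exec w (.branch r p q) σ σ' (T + 1)
  | branch_false {r : ℕ} {p q : Prog} {σ σ' : State} {T : ℕ} (hr : σ.reg r = 0)
      (hq : Exec w q σ σ' T) : Exec w (.branch r p q) σ σ' (T + 1)
  | loop_done {r : ℕ} {p : Prog} {σ : State} (hr : σ.reg r = 0) : Exec w (.loop r p) σ σ 1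
  | loop_step {r : ℕ} {p : Prog} {σ σ' σ'' : State} {T T' : ℕ} (hr : σ.reg r ≠ 0)
      (hp : Exec w p σ σ' T) (hl : Exec w (.loop r p) σ' σ'' T') :
      Exec w (.loop r p) σ σ'' (T + T' + 1)

end WordRAM

/-! ### Satisfiability and the strong exponential time hypothesis -/

namespace SAT

open WordRAM

/-- A literal: `(x, true)` is the variable `x`, `(x, false)` its negation. -/
abbrev Literal (n : ℕ) := Fin n × Bool

/-- A CNF formula on `n` variables: a list of clauses, each a list of literals. -/
abbrev CNF (n : ℕ) := List (List (Literal n))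

/-- Some assignment makes a literal of every clause true. -/
def Satisfiable {n : ℕ} (φ : CNF n) : Prop :=
  ∃ a : Fin n → Bool, ∀ c ∈ φ, ∃ l ∈ c, a l.1 = l.2

/-- Every clause has at most `k` literals. -/
def IsKCNF {n : ℕ} (k : ℕ) (φ : CNF n) : Prop := ∀ c ∈ φ, c.length ≤ k

/-- Code of a literal, a positive number. -/
def Literal.code {n : ℕ} (l : Literal n) : ℕ := 2 * l.1.val + (if l.2 then 1 else 0) + 1

/-- The input of a program for `k`-SAT: register `0` holds the number of variables, register `1` the
number of clauses, and cell `j * k + i` (`i < k`) of array `0` the code of the `i`-th literal of the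
`j`-th clause, or `0` if there is no such literal. All the rest is zero. -/
def inputState {n : ℕ} (k : ℕ) (φ : CNF n) : State where
  reg := fun r => if r = 0 then n else if r = 1 then φ.length else 0
  mem := fun M x =>
    if M = 0 then (((φ.getD (x / k) []).map Literal.code).getD (x % k) 0) else 0

/-- `P` decides `k`-SAT in time `2 ^ ((1 - δ) n) · poly(n + number of clauses)` on a word RAM with
words of `O(n + log (number of clauses))` bits; the answer is left in register `0`. -/
def SolvesKSAT (P : Prog) (k : ℕ) (δ : ℝ) : Prop :=
  ∃ (c d : ℕ) (C : ℝ), ∀ (n : ℕ) (φ : CNF n), IsKCNF k φ →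
    ∃ (σ : State) (T : ℕ),
      Exec (c * (n + Nat.log 2 (φ.length + 1) + 1)) P (inputState k φ) σ T ∧
      (σ.reg 0 = 1 ↔ Satisfiable φ) ∧
      (T : ℝ) ≤ C * (2 : ℝ) ^ ((1 - δ) * (n : ℝ)) * ((n : ℝ) + (φ.length : ℝ) + 1) ^ d

/-- The strong exponential time hypothesis: for every `δ > 0` there is `k ≥ 3` such that `k`-SAT on
`n` variables cannot be decided in time `2 ^ ((1 - δ) n)` up to polynomial factors. -/
def SETH : Prop :=
  ∀ δ : ℝ, 0 < δ → ∃ k : ℕ, 3 ≤ k ∧ ¬ ∃ P : Prog, SolvesKSAT P k δ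

end SAT

/-! ### Partially dynamic maximum flow -/

namespace DynFlow

open WordRAM

/-- A directed graph on `n` nodes with positive integer capacities on its edges: `G u v` is the
capacity of the edge `(u, v)`, and `0` means that there is no such edge. -/
abbrev CapGraph (n : ℕ) := Fin n → Fin n → ℕ

/-- Set the capacity of the pair `(u, v)` to `c`. -/
def CapGraph.setCap {n : ℕ} (G : CapGraph n) (u v : Fin n) (c : ℕ) : CapGraph n :=
  fun x y => if x = u ∧ y = v then c else G x y

/-- The number of edges. -/
def CapGraph.numEdges {n : ℕ} (G : CapGraph n) : ℕ :=
  (Finset.univ.filter fun e : Fin n × Fin n => 0 < G e.1 e.2).card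

/-- `f` is an `s`-`t` flow: it obeys the capacities and is conserved at all nodes but `s`, `t`. -/
def IsFlow {n : ℕ} (G : CapGraph n) (s t : Fin n) (f : Fin n → Fin n → ℝ) : Prop :=
  (∀ u v, 0 ≤ f u v ∧ f u v ≤ (G u v : ℝ)) ∧
    ∀ v, v ≠ s → v ≠ t → ∑ u, f u v = ∑ u, f v u

/-- The value of a flow: what leaves `s` minus what enters `s`. -/
def flowValue {n : ℕ} (s : Fin n) (f : Fin n → Fin n → ℝ) : ℝ :=
  ∑ v, f s v - ∑ v, f v s

/-- `x` is the maximum value of an `s`-`t` flow. -/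
def IsMaxFlowValue {n : ℕ} (G : CapGraph n) (s t : Fin n) (x : ℝ) : Prop :=
  IsGreatest {y : ℝ | ∃ f, IsFlow G s t f ∧ flowValue s f = y} x

/-- Only edge insertions, or only edge deletions. -/
inductive Mode where
  | incremental
  | decremental

/-- The operations on a dynamic graph. -/
inductive Op (n : ℕ) where
  /-- insert the edge `(u, v)` with capacity `c` -/
  | insert (u v : Fin n) (c : ℕ)
  /-- delete the edge `(u, v)` -/
  | delete (u v : Fin n)
  /-- ask for the maximum flow value -/
  | query

/-- The graph after an operation. -/
def Op.apply {n : ℕ} (G : CapGraph n) : Op n → CapGraph n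
  | .insert u v c => G.setCap u v c
  | .delete u v => G.setCap u v 0
  | .query => G

/-- The capacity that an operation mentions. -/
def Op.capacity {n : ℕ} : Op n → ℕ
  | .insert _ _ c => c
  | .delete _ _ => 0
  | .query => 0

/-- The operation is allowed in the mode and makes sense in the graph `G`: insertions add a new edge
that is not a loop, with positive capacity, and deletions remove an existing edge. -/
def Op.Legal {n : ℕ} (mode : Mode) (G : CapGraph n) : Op n → Prop
  | .insert u v c => mode = .incremental ∧ u ≠ v ∧ G u v = 0 ∧ 0 < c
  | .delete u v => mode = .decremental ∧ 0 < G u v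
  | .query => True

/-- All operations of a sequence are legal when performed one after the other from `G` on. -/
def LegalOps {n : ℕ} (mode : Mode) : CapGraph n → List (Op n) → Prop
  | _, [] => True
  | G, o :: os => o.Legal mode G ∧ LegalOps mode (o.apply G) os

/-- An input for dynamic maximum flow: nodes `Fin n`, source, sink, the edges `(u, v, c)` of the
starting graph and the sequence of operations. -/
structure Instance where
  n : ℕ
  s : Fin n
  t : Fin n
  edges : List (Fin n × Fin n × ℕ)
  ops : List (Op n)

/-- The starting graph. -/
def Instance.startGraph (I : Instance) : CapGraph I.n :=
  I.edges.foldl (fun G e => G.setCap e.1 e.2.1 e.2.2) (fun _ _ => 0)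

/-- The graph after all operations. -/
def Instance.finalGraph (I : Instance) : CapGraph I.n :=
  I.ops.foldl Op.apply I.startGraph

/-- The parameter `m`: the largest number of edges that are present at any time. As edges are only
inserted or only deleted, it is attained at the start or at the end. -/
def Instance.m (I : Instance) : ℕ := max I.startGraph.numEdges I.finalGraph.numEdges

/-- Validity: source and sink differ, the starting edges form a simple digraph with positive
capacities, which has no edges in the incremental case, and all operations are legal. -/
def Instance.Valid (mode : Mode) (I : Instance) : Prop :=
  I.s ≠ I.t ∧
  (I.edges.map fun e => (e.1, e.2.1)).Nodup ∧
  (∀ e ∈ I.edges, e.1 ≠ e.2.1 ∧ 0 < e.2.2) ∧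
  (mode = .incremental → I.edges = []) ∧
  LegalOps mode I.startGraph I.ops

/-- The graph always has `Õ(n)` edges, namely at most `K n (log n) ^ p`. -/
def Instance.Sparse (K p : ℕ) (I : Instance) : Prop :=
  I.m ≤ K * I.n * (Nat.log 2 I.n) ^ p

/-- A number whose logarithm determines the word size: it bounds the number of nodes, starting edges
and operations, and the sum of all capacities. -/
def Instance.size (I : Instance) : ℕ :=
  I.n + I.edges.length + I.ops.length +
    ((I.edges.map fun e => e.2.2).sum + (I.ops.map Op.capacity).sum)

/-- What the algorithm is given at the start: the number of nodes, `s`, `t` and the number of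
starting edges in registers `0` to `3`, and tails, heads and capacities of the starting edges in
arrays `0`, `1`, `2`. All the rest is zero. -/
def Instance.startState (I : Instance) : State where
  reg := fun r =>
    if r = 0 then I.n else if r = 1 then I.s.val else if r = 2 then I.t.val
    else if r = 3 then I.edges.length else 0
  mem := fun M i =>
    if M = 0 then (I.edges.map fun e => e.1.val).getD i 0
    else if M = 1 then (I.edges.map fun e => e.2.1.val).getD i 0
    else if M = 2 then (I.edges.map fun e => e.2.2).getD i 0
    else 0

/-- A partially dynamic algorithm: a program that is run once at the start, one that is run for
every insertion or deletion, and one that is run for every query. The memory persists. -/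
structure Algorithm where
  setup : Prog
  update : Prog
  query : Prog

/-- Pass the arguments of an update in registers `0`, `1`, `2`. -/
def passArgs (σ : State) (u v c : ℕ) : State :=
  ((σ.setReg 0 u).setReg 1 v).setReg 2 c

/-- `A.Serves w s t G σ ops T`: with current graph `G` and memory `σ`, the algorithm processes the
operations `ops` online, one after the other, in `T` steps altogether, and after every query
register `0` holds the maximum flow value of the graph at that time. -/
inductive Algorithm.Serves (A : Algorithm) (w : ℕ) {n : ℕ} (s t : Fin n) :
    CapGraph n → State → List (Op n) → ℕ → Prop
  | nil (G : CapGraph n) (σ : State) : A.Serves w s t G σ [] 0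
  | insert {G : CapGraph n} {σ σ' : State} {ops : List (Op n)} {T T' : ℕ} (u v : Fin n) (c : ℕ)
      (hrun : Exec w A.update (passArgs σ u.val v.val c) σ' T)
      (hrest : A.Serves w s t (Op.apply G (.insert u v c)) σ' ops T') :
      A.Serves w s t G σ (.insert u v c :: ops) (T + T')
  | delete {G : CapGraph n} {σ σ' : State} {ops : List (Op n)} {T T' : ℕ} (u v : Fin n)
      (hrun : Exec w A.update (passArgs σ u.val v.val 0) σ' T)
      (hrest : A.Serves w s t (Op.apply G (.delete u v)) σ' ops T') :
      A.Serves w s t G σ (.delete u v :: ops) (T + T')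
  | query {G : CapGraph n} {σ σ' : State} {ops : List (Op n)} {T T' : ℕ}
      (hrun : Exec w A.query σ σ' T)
      (hans : IsMaxFlowValue G s t (σ'.reg 0 : ℝ))
      (hrest : A.Serves w s t G σ' ops T') :
      A.Serves w s t G σ (.query :: ops) (T + T')

/-- `A` solves incremental (decremental) maximum `s`-`t` flow on graphs with at most
`K n (log n) ^ p` edges, on a word RAM with words of logarithmically many bits, with amortized time
`O(m ^ (1 - ε))` per operation. There is no free preprocessing: the total time includes the setup.
In exchange every node and every edge of the starting graph counts as an operation, next to the
updates and queries. -/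
def Algorithm.Solves (A : Algorithm) (mode : Mode) (K p : ℕ) (ε : ℝ) : Prop :=
  ∃ (c : ℕ) (C : ℝ), ∀ I : Instance, I.Valid mode → I.Sparse K p →
    ∃ (σ : State) (T₀ T₁ : ℕ),
      Exec (c * (Nat.log 2 I.size + 1)) A.setup I.startState σ T₀ ∧
      A.Serves (c * (Nat.log 2 I.size + 1)) I.s I.t I.startGraph σ I.ops T₁ ∧
      ((T₀ + T₁ : ℕ) : ℝ) ≤
        C * ((I.n : ℝ) + (I.edges.length : ℝ) + (I.ops.length : ℝ)) *
          ((I.m : ℝ) + 1) ^ (1 - ε)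

end DynFlow

/-! The reduction splits an assignment into two halves. With `h = ⌈n / 2⌉` there are `N = 2 ^ h`
assignments of each half, and a formula with `M` clauses is satisfiable iff some pair `(x, b)` of
halves has no clause that both of them fail. If this can be decided by `O(N (M + 1))` flow
operations on a graph with `O(N (M + 1))` edges, then time `O(m ^ (1 - ε))` per operation adds up to
`N ^ (2 - ε) · poly(M)`, which is `2 ^ ((1 - ε / 2) n) · poly` and contradicts SETH.

The network has a path `x → c_j → b` exactly when both `x` and `b` fail clause `j`, and a unit arc
from every `b` to the sink. So `N` units from `x₀` reach the sink iff every `b` is reachable from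
`x₀`, that is, iff `x₀` does not extend to a satisfying assignment. All `x` have to be tested with
insertions only or deletions only, so the other elements are neutralized instead of removed: an
element with arcs of capacity `N` both from the source and to the sink sends its `N` units straight
through. A phase inserts `s → x`, asks, and inserts `x → t`; or it deletes `x → t`, asks, and
deletes `s → x`. In both cases the answer falls below `N` times the number of source arcs iff `x`
extends (`Net.maxFlow_lt_iff`, proved with one explicit cut and one explicit flow).

The rest makes the reduction a word RAM program. `Exec.embed` runs the flow algorithm as a guest at
unchanged cost, `Emits` abstracts from what is done with a generated arc (performing an update or
writing a starting edge), and `runs_phases` and `runs_satProg` assemble the program. `log_size_le`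
and `flow_time_le` bound its words and its time. -/

namespace WordRAM

theorem Exec.mono {w w' : ℕ} (hw : w ≤ w') {p : Prog} {σ σ' : State} {T : ℕ}
    (h : Exec w p σ σ' T) : Exec w' p σ σ' T := by
  have hpow : 2 ^ w ≤ 2 ^ w' := Nat.pow_le_pow_right (by norm_num) hw
  induction h with
  | skip σ => exact .skip σ
  | const σ r v h => exact .const σ r v (h.trans_le hpow)
  | bin σ f r a b h => exact .bin σ f r a b (h.trans_le hpow)
  | load σ r M i => exact .load σ r M i
  | store σ M i r => exact .store σ M i r
  | seq _ _ ihp ihq => exact .seq ihp ihq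
  | branch_true hr _ ih => exact .branch_true hr ih
  | branch_false hr _ ih => exact .branch_false hr ih
  | loop_done hr => exact .loop_done hr
  | loop_step hr _ _ ihp ihl => exact .loop_step hr ihp ihl

/-! ### Running a program inside another one

The host keeps its variables in the registers `3 * r`, its temporaries in the registers
`3 * r + 1` and its input in array `0`. The guest lives in the registers `3 * r + 2` and in the
arrays `M + 1`. -/

/-- The program with its registers and arrays moved to those of the guest. -/
def Prog.embed : Prog → Prog
  | .skip => .skip
  | .const r v => .const (3 * r + 2) v
  | .bin f r a b => .bin f (3 * r + 2) (3 * a + 2) (3 * b + 2)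
  | .load r M i => .load (3 * r + 2) (M + 1) (3 * i + 2)
  | .store M i r => .store (M + 1) (3 * i + 2) (3 * r + 2)
  | .seq p q => .seq p.embed q.embed
  | .branch r p q => .branch (3 * r + 2) p.embed q.embed
  | .loop r p => .loop (3 * r + 2) p.embed

/-- `σ` consists of the input `inp`, the variables `v` of the host and the state `τ` of the
guest, with arbitrary temporaries. -/
structure Rep (inp : ℕ → ℕ) (v : ℕ → ℕ) (τ σ : State) : Prop where
  var : ∀ r, σ.reg (3 * r) = v r
  reg : ∀ r, σ.reg (3 * r + 2) = τ.reg r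
  inp : σ.mem 0 = inp
  mem : ∀ M, σ.mem (M + 1) = τ.mem M

variable {inp v : ℕ → ℕ} {τ σ : State} {w : ℕ}

theorem Rep.setVar (h : Rep inp v τ σ) (r x : ℕ) :
    Rep inp (Function.update v r x) τ (σ.setReg (3 * r) x) where
  var s := by
    by_cases hs : s = r
    · simp [State.setReg, hs]
    · simp [State.setReg, hs, h.var]
  reg s := by
    rw [← h.reg, State.setReg]
    exact Function.update_of_ne (by omega) _ _
  inp := h.inp
  mem := h.mem

theorem Rep.setTmp (h : Rep inp v τ σ) (r x : ℕ) : Rep inp v τ (σ.setReg (3 * r + 1) x) where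
  var s := by
    rw [← h.var, State.setReg]
    exact Function.update_of_ne (by omega) _ _
  reg s := by
    rw [← h.reg, State.setReg]
    exact Function.update_of_ne (by omega) _ _
  inp := h.inp
  mem := h.mem

theorem Rep.setGuest (h : Rep inp v τ σ) (r x : ℕ) :
    Rep inp v (τ.setReg r x) (σ.setReg (3 * r + 2) x) where
  var s := by
    rw [← h.var, State.setReg]
    exact Function.update_of_ne (by omega) _ _
  reg s := by
    by_cases hs : s = r
    · simp [State.setReg, hs]
    · simp [State.setReg, hs, h.reg]
  inp := h.inp
  mem := h.mem

theorem Rep.setGuestMem (h : Rep inp v τ σ) (M i x : ℕ) :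
    Rep inp v (τ.setMem M i x) (σ.setMem (M + 1) i x) where
  var := h.var
  reg := h.reg
  inp := by simp [State.setMem, h.inp]
  mem s := by
    by_cases hs : s = M
    · subst hs; simp [State.setMem, h.mem]
    · simp [State.setMem, hs, h.mem]

/-- Instructions are translated one to one, so the number of steps is exactly preserved and a bound
on the total time of the guest carries over without loss. -/
theorem Exec.embed {p : Prog} {τ τ' : State} {T : ℕ} (h : Exec w p τ τ' T) :
    ∀ {σ : State}, Rep inp v τ σ → ∃ σ', Exec w p.embed σ σ' T ∧ Rep inp v τ' σ' := by
  induction h with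
  | skip τ => exact fun hσ => ⟨_, .skip _, hσ⟩
  | const τ r x hx => exact fun hσ => ⟨_, .const _ _ _ hx, hσ.setGuest r x⟩
  | bin τ f r a b hx =>
    intro σ hσ
    rw [← hσ.reg a, ← hσ.reg b] at hx ⊢
    exact ⟨_, .bin _ _ _ _ _ hx, hσ.setGuest r _⟩
  | load τ r M i =>
    intro σ hσ
    rw [← hσ.reg i, ← hσ.mem M]
    exact ⟨_, .load _ _ _ _, hσ.setGuest r _⟩
  | store τ M i r =>
    intro σ hσ
    rw [← hσ.reg i, ← hσ.reg r]
    exact ⟨_, .store _ _ _ _, hσ.setGuestMem M _ _⟩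
  | seq _ _ ihp ihq =>
    intro σ hσ
    obtain ⟨σ', h', hσ'⟩ := ihp hσ
    obtain ⟨σ'', h'', hσ''⟩ := ihq hσ'
    exact ⟨σ'', .seq h' h'', hσ''⟩
  | branch_true hr _ ih =>
    intro σ hσ
    obtain ⟨σ', h', hσ'⟩ := ih hσ
    exact ⟨σ', .branch_true (by rwa [hσ.reg]) h', hσ'⟩
  | branch_false hr _ ih =>
    intro σ hσ
    obtain ⟨σ', h', hσ'⟩ := ih hσ
    exact ⟨σ', .branch_false (by rwa [hσ.reg]) h', hσ'⟩
  | loop_done hr => exact fun hσ => ⟨_, .loop_done (by rwa [hσ.reg]), hσ⟩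
  | loop_step hr _ _ ihp ihl =>
    intro σ hσ
    obtain ⟨σ', h', hσ'⟩ := ihp hσ
    obtain ⟨σ'', h'', hσ''⟩ := ihl hσ'
    exact ⟨σ'', .loop_step (by rwa [hσ.reg]) h' h'', hσ''⟩

/-! ### Expressions -/

/-- Expressions over the variables and the input of the host. -/
inductive Expr where
  | var (r : ℕ)
  | num (c : ℕ)
  | bin (f : BinOp) (a b : Expr)
  | load (a : Expr)

namespace Expr

/-- The value of an expression. -/
def eval (inp v : ℕ → ℕ) : Expr → ℕ
  | var r => v r
  | num c => c
  | bin f a b => f.eval (a.eval inp v) (b.eval inp v)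
  | load a => inp (a.eval inp v)

/-- Evaluation of an expression into the temporary with number `d`. -/
def compile : Expr → ℕ → Prog
  | var r, d => .bin .or (3 * d + 1) (3 * r) (3 * r)
  | num c, d => .const (3 * d + 1) c
  | bin f a b, d => .seq (a.compile d) (.seq (b.compile (d + 1))
      (.bin f (3 * d + 1) (3 * d + 1) (3 * (d + 1) + 1)))
  | load a, d => .seq (a.compile d) (.load (3 * d + 1) 0 (3 * d + 1))

/-- The number of steps of the evaluation. -/
def cost : Expr → ℕ
  | var _ => 1
  | num _ => 1
  | bin _ a b => a.cost + (b.cost + 1)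
  | load a => a.cost + 1

/-- All values that occur in the evaluation fit into words. -/
def Fits (w : ℕ) (inp v : ℕ → ℕ) : Expr → Prop
  | var r => v r < 2 ^ w
  | num c => c < 2 ^ w
  | bin f a b => a.Fits w inp v ∧ b.Fits w inp v ∧
      f.eval (a.eval inp v) (b.eval inp v) < 2 ^ w
  | load a => a.Fits w inp v ∧ inp (a.eval inp v) < 2 ^ w

theorem Fits.eval_lt {e : Expr} (h : e.Fits w inp v) : e.eval inp v < 2 ^ w := by
  cases e with
  | var r => exact h
  | num c => exact h
  | bin f a b => exact h.2.2
  | load a => exact h.2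

/-- The temporaries form a stack: evaluation at depth `d` preserves those below `d`, so the left
operand of a binary expression survives the evaluation of the right one. -/
theorem exec_compile (e : Expr) : ∀ {d : ℕ} {σ : State}, e.Fits w inp v → Rep inp v τ σ →
    ∃ σ', Exec w (e.compile d) σ σ' e.cost ∧ Rep inp v τ σ' ∧
      σ'.reg (3 * d + 1) = e.eval inp v ∧
      ∀ d' < d, σ'.reg (3 * d' + 1) = σ.reg (3 * d' + 1) := by
  induction e with
  | var r =>
    intro d σ he hσ
    -- There is no move instruction; `x ||| x` serves as a copy.
    have : BinOp.or.eval (σ.reg (3 * r)) (σ.reg (3 * r)) = v r := by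
      simp [BinOp.eval, hσ.var]
    refine ⟨_, .bin _ _ _ _ _ (by rw [this]; exact he), hσ.setTmp _ _, ?_, ?_⟩
    · simp [State.setReg, this, eval]
    · intro d' hd'
      exact Function.update_of_ne (by omega) _ _
  | num c =>
    intro d σ he hσ
    refine ⟨_, .const _ _ _ he, hσ.setTmp _ _, ?_, ?_⟩
    · simp [State.setReg, eval]
    · intro d' hd'
      exact Function.update_of_ne (by omega) _ _
  | bin f a b iha ihb =>
    intro d σ he hσ
    obtain ⟨σ₁, h₁, r₁, e₁, k₁⟩ := iha (d := d) he.1 hσ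
    obtain ⟨σ₂, h₂, r₂, e₂, k₂⟩ := ihb (d := d + 1) he.2.1 r₁
    have e₁' : σ₂.reg (3 * d + 1) = a.eval inp v := by rw [k₂ d (by omega), e₁]
    refine ⟨_, .seq h₁ (.seq h₂ (.bin _ _ _ _ _ ?_)), r₂.setTmp _ _, ?_, ?_⟩
    · rw [e₁', e₂]; exact he.2.2
    · simp only [State.setReg, Function.update_self, e₁', e₂, eval]
    · intro d' hd'
      rw [← k₁ d' hd', ← k₂ d' (by omega)]
      exact Function.update_of_ne (by omega) _ _
  | load a iha =>
    intro d σ he hσ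
    obtain ⟨σ₁, h₁, r₁, e₁, k₁⟩ := iha (d := d) he.1 hσ
    refine ⟨_, .seq h₁ (.load _ _ _ _), r₁.setTmp _ _, ?_, ?_⟩
    · simp only [State.setReg, Function.update_self, e₁, r₁.inp, eval]
    · intro d' hd'
      rw [← k₁ d' hd']
      exact Function.update_of_ne (by omega) _ _

/-- A number of blocks of bits that suffices for all values in the evaluation. -/
def size : Expr → ℕ
  | var _ => 1
  | num c => c + 1
  | bin _ a b => a.size + b.size
  | load a => a.size + 1

/-- The expression has no left shifts. -/
def NoShl : Expr → Prop
  | var _ => True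
  | num _ => True
  | bin f a b => f ≠ .shl ∧ a.NoShl ∧ b.NoShl
  | load a => a.NoShl

theorem one_le_size (e : Expr) : 1 ≤ e.size := by
  induction e <;> simp only [size] <;> omega

/-- Bit lengths at most add up under every instruction except the left shift, whose result can be
exponentially long. A fixed expression without left shifts therefore needs only a constant number of
blocks of bits. -/
theorem _root_.WordRAM.BinOp.eval_lt_two_pow {f : BinOp} (hf : f ≠ .shl) {a b x y : ℕ}
    (hx : 1 ≤ x) (hy : 1 ≤ y) (ha : a < 2 ^ x) (hb : b < 2 ^ y) : f.eval a b < 2 ^ (x + y) := by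
  have hax : 2 ^ x ≤ 2 ^ (x + y) := Nat.pow_le_pow_right (by norm_num) (by omega)
  have hby : 2 ^ y ≤ 2 ^ (x + y) := Nat.pow_le_pow_right (by norm_num) (by omega)
  have h2 : 1 < 2 ^ (x + y) := Nat.one_lt_two_pow (by omega)
  have ha' := ha.trans_le hax
  have hb' := hb.trans_le hby
  cases f with
  | add =>
    have : 2 ≤ 2 ^ x := Nat.le_self_pow (by omega) 2
    have : 2 ≤ 2 ^ y := Nat.le_self_pow (by omega) 2
    simp only [BinOp.eval]
    rw [pow_add]
    nlinarith
  | sub => exact (Nat.sub_le _ _).trans_lt ha'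
  | mul => simp only [BinOp.eval]; rw [pow_add]; exact Nat.mul_lt_mul'' ha hb
  | div => exact (Nat.div_le_self _ _).trans_lt ha'
  | mod => exact (Nat.mod_le _ _).trans_lt ha'
  | and => exact Nat.and_lt_two_pow _ hb'
  | or => exact Nat.or_lt_two_pow ha' hb'
  | xor => exact Nat.xor_lt_two_pow ha' hb'
  | shl => exact absurd rfl hf
  | shr => exact (Nat.shiftRight_le _ _).trans_lt ha'
  | lt => simp only [BinOp.eval]; split_ifs <;> omega
  | eq => simp only [BinOp.eval]; split_ifs <;> omega

theorem eval_lt_two_pow {W : ℕ} (hW : 1 ≤ W) (hv : ∀ r, v r < 2 ^ W) (hi : ∀ x, inp x < 2 ^ W)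
    (e : Expr) (he : e.NoShl) : e.eval inp v < 2 ^ (e.size * W) := by
  induction e with
  | var r => simpa [eval, size] using hv r
  | num c =>
    refine (Nat.lt_two_pow_self (n := c)).trans_le (Nat.pow_le_pow_right (by norm_num) ?_)
    simp only [size]
    nlinarith
  | bin f a b iha ihb =>
    simp only [eval, size, add_mul]
    exact BinOp.eval_lt_two_pow he.1 (Nat.mul_pos a.one_le_size hW)
      (Nat.mul_pos b.one_le_size hW) (iha he.2.1) (ihb he.2.2)
  | load a _ =>
    refine (hi _).trans_le (Nat.pow_le_pow_right (by norm_num) ?_)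
    simp only [size]
    nlinarith

theorem fits_of_size {W : ℕ} (hW : 1 ≤ W) (hv : ∀ r, v r < 2 ^ W) (hi : ∀ x, inp x < 2 ^ W)
    (e : Expr) (he : e.NoShl) (hw : e.size * W ≤ w) : e.Fits w inp v := by
  have hlt (e : Expr) (he : e.NoShl) (hw : e.size * W ≤ w) : e.eval inp v < 2 ^ w :=
    (eval_lt_two_pow hW hv hi e he).trans_le (Nat.pow_le_pow_right (by norm_num) hw)
  induction e with
  | var r => exact hlt (.var r) he hw
  | num c => exact hlt (.num c) he hw
  | bin f a b iha ihb =>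
    have hw' := hw
    rw [size, add_mul] at hw'
    exact ⟨iha he.2.1 (by omega), ihb he.2.2 (by omega), hlt (.bin f a b) he hw⟩
  | load a iha =>
    have hw' := hw
    rw [size, add_mul] at hw'
    exact ⟨iha he (by omega), hlt (.load a) he hw⟩

end Expr

/-! ### Runs on pairs of host variables and guest states -/

/-- From variables `v` and guest state `τ` the program `p` halts with variables `v'` and guest
state `τ'` within `T` steps. -/
def Runs (w : ℕ) (inp : ℕ → ℕ) (p : Prog) (v : ℕ → ℕ) (τ : State) (v' : ℕ → ℕ) (τ' : State)
    (T : ℕ) : Prop :=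
  ∀ σ, Rep inp v τ σ → ∃ σ' T', Exec w p σ σ' T' ∧ T' ≤ T ∧ Rep inp v' τ' σ'

variable {v' v'' : ℕ → ℕ} {τ' τ'' : State} {p q : Prog} {T T' : ℕ}

theorem Runs.mono (h : Runs w inp p v τ v' τ' T) (hT : T ≤ T') : Runs w inp p v τ v' τ' T' :=
  fun σ hσ =>
    let ⟨σ', S, h₁, h₂, h₃⟩ := h σ hσ
    ⟨σ', S, h₁, h₂.trans hT, h₃⟩

theorem Runs.seq (hp : Runs w inp p v τ v' τ' T) (hq : Runs w inp q v' τ' v'' τ'' T') :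
    Runs w inp (.seq p q) v τ v'' τ'' (T + T') := fun σ hσ =>
  let ⟨σ', _, h₁, h₂, h₃⟩ := hp σ hσ
  let ⟨σ'', _, k₁, k₂, k₃⟩ := hq σ' h₃
  ⟨σ'', _, .seq h₁ k₁, Nat.add_le_add h₂ k₂, k₃⟩

theorem Runs.embed (h : Exec w p τ τ' T) : Runs w inp p.embed v τ v τ' T := fun _ hσ =>
  let ⟨σ', h₁, h₂⟩ := h.embed hσ
  ⟨σ', T, h₁, le_rfl, h₂⟩

theorem Runs.loop_done {r : ℕ} (hr : v r = 0) : Runs w inp (.loop (3 * r) p) v τ v τ 1 :=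
  fun σ hσ => ⟨σ, 1, .loop_done (by rw [hσ.var, hr]), le_rfl, hσ⟩

theorem Runs.loop_step {r : ℕ} (hr : v r ≠ 0) (hp : Runs w inp p v τ v' τ' T)
    (hl : Runs w inp (.loop (3 * r) p) v' τ' v'' τ'' T') :
    Runs w inp (.loop (3 * r) p) v τ v'' τ'' (T + T' + 1) := fun σ hσ =>
  let ⟨σ', _, h₁, h₂, h₃⟩ := hp σ hσ
  let ⟨σ'', _, k₁, k₂, k₃⟩ := hl σ' h₃
  ⟨σ'', _, .loop_step (by rwa [hσ.var]) h₁ k₁, by omega, k₃⟩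

/-- Assign the value of an expression to a variable. -/
def assign (r : ℕ) (e : Expr) : Prog := .seq (e.compile 0) (.bin .or (3 * r) 1 1)

/-- Assign the value of an expression to a register of the guest. -/
def setGuest (r : ℕ) (e : Expr) : Prog := .seq (e.compile 0) (.bin .or (3 * r + 2) 1 1)

/-- Write the value of an expression to an array of the guest, to the cell whose index is in
register `i` of the guest. -/
def storeGuest (M i : ℕ) (e : Expr) : Prog := .seq (e.compile 0) (.store (M + 1) (3 * i + 2) 1)

/-- Set the variable `r` to its bitwise disjunction with the truth value of the comparison of
register `a` of the guest with an expression. -/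
def orGuestLt (r a : ℕ) (e : Expr) : Prog :=
  .seq (e.compile 0) (.seq (.bin .lt 1 (3 * a + 2) 1) (.bin .or (3 * r) (3 * r) 1))

theorem runs_assign {e : Expr} (r : ℕ) (he : e.Fits w inp v) :
    Runs w inp (assign r e) v τ (Function.update v r (e.eval inp v)) τ (e.cost + 1) := by
  intro σ hσ
  obtain ⟨σ₁, h₁, r₁, e₁, -⟩ := e.exec_compile (d := 0) he hσ
  have e₁' : BinOp.or.eval (σ₁.reg 1) (σ₁.reg 1) = e.eval inp v := by
    simpa [BinOp.eval] using e₁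
  refine ⟨_, _, .seq h₁ (.bin _ _ _ _ _ ?_), le_rfl, ?_⟩
  · rw [e₁']; exact he.eval_lt
  · rw [e₁']; exact r₁.setVar _ _

theorem runs_setGuest {e : Expr} (r : ℕ) (he : e.Fits w inp v) :
    Runs w inp (setGuest r e) v τ v (τ.setReg r (e.eval inp v)) (e.cost + 1) := by
  intro σ hσ
  obtain ⟨σ₁, h₁, r₁, e₁, -⟩ := e.exec_compile (d := 0) he hσ
  have e₁' : BinOp.or.eval (σ₁.reg 1) (σ₁.reg 1) = e.eval inp v := by
    simpa [BinOp.eval] using e₁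
  refine ⟨_, _, .seq h₁ (.bin _ _ _ _ _ ?_), le_rfl, ?_⟩
  · rw [e₁']; exact he.eval_lt
  · rw [e₁']; exact r₁.setGuest _ _

theorem runs_storeGuest {e : Expr} (M i : ℕ) (he : e.Fits w inp v) :
    Runs w inp (storeGuest M i e) v τ v (τ.setMem M (τ.reg i) (e.eval inp v)) (e.cost + 1) := by
  intro σ hσ
  obtain ⟨σ₁, h₁, r₁, e₁, -⟩ := e.exec_compile (d := 0) he hσ
  refine ⟨_, _, .seq h₁ (.store _ _ _ _), le_rfl, ?_⟩
  rw [r₁.reg, ← e₁]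
  exact r₁.setGuestMem _ _ _

theorem runs_orGuestLt {e : Expr} (r a : ℕ) (he : e.Fits w inp v) (hw : 1 ≤ w)
    (hr : v r < 2 ^ w) :
    Runs w inp (orGuestLt r a e) v τ
      (Function.update v r (v r ||| if τ.reg a < e.eval inp v then 1 else 0)) τ (e.cost + 2) := by
  intro σ hσ
  obtain ⟨σ₁, h₁, r₁, e₁, -⟩ := e.exec_compile (d := 0) he hσ
  have h2 : 1 < 2 ^ w := Nat.one_lt_two_pow (by omega)
  have e₂ : BinOp.lt.eval (σ₁.reg (3 * a + 2)) (σ₁.reg 1) =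
      if τ.reg a < e.eval inp v then 1 else 0 := by
    have e₁' : σ₁.reg 1 = e.eval inp v := e₁
    simp only [BinOp.eval, r₁.reg, e₁']
  set y := BinOp.lt.eval (σ₁.reg (3 * a + 2)) (σ₁.reg 1) with hy
  have hy2 : y < 2 ^ w := by rw [e₂]; split_ifs <;> omega
  have e₃ : BinOp.or.eval ((σ₁.setReg 1 y).reg (3 * r)) ((σ₁.setReg 1 y).reg 1) =
      v r ||| if τ.reg a < e.eval inp v then 1 else 0 := by
    rw [← e₂, ← (r₁.setTmp 0 y).var]
    simp [BinOp.eval, State.setReg]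
  refine ⟨_, _, .seq h₁ (.seq (.bin _ _ _ _ _ hy2) (.bin _ _ _ _ _ ?_)), le_rfl, ?_⟩
  · rw [e₃, ← e₂]; exact Nat.or_lt_two_pow hr hy2
  · rw [e₃]; exact (r₁.setTmp 0 y).setVar _ _

end WordRAM

/-! ### Cuts, flows and the covering network. -/

namespace DynFlow

open Finset

/-! ### Cuts -/

/-- The total capacity of the edges that leave a set of nodes. -/
def cutCap {n : ℕ} (S : Finset (Fin n)) : CapGraph n →+ ℕ where
  toFun G := ∑ u ∈ S, ∑ v ∈ Sᶜ, G u v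
  map_zero' := by simp
  map_add' G H := by simp [sum_add_distrib]

/-- Weak duality: conservation summed over `S` leaves the net flow out of `S`. The max-flow min-cut
theorem itself is not needed, because every query is decided by an explicit cut or an explicit flow.
-/
theorem IsFlow.value_le_cutCap {n : ℕ} {G : CapGraph n} {s t : Fin n} {f : Fin n → Fin n → ℝ}
    (hf : IsFlow G s t f) {S : Finset (Fin n)} (hs : s ∈ S) (ht : t ∉ S) :
    flowValue s f ≤ (cutCap S G : ℝ) := by
  have h1 : flowValue s f = ∑ u ∈ S, (∑ v, f u v - ∑ v, f v u) := by
    rw [sum_eq_single_of_mem s hs]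
    · rfl
    · intro u hu hus
      rw [hf.2 u hus (fun h => ht (h ▸ hu)), sub_self]
  have h2 : ∑ u ∈ S, ∑ v ∈ S, f u v = ∑ u ∈ S, ∑ v ∈ S, f v u := sum_comm
  have h3 : 0 ≤ ∑ u ∈ S, ∑ v ∈ Sᶜ, f v u :=
    sum_nonneg fun u _ => sum_nonneg fun v _ => (hf.1 v u).1
  have h4 : ∑ u ∈ S, ∑ v ∈ Sᶜ, f u v ≤ (cutCap S G : ℝ) := by
    simp only [cutCap, AddMonoidHom.coe_mk, ZeroHom.coe_mk, Nat.cast_sum]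
    exact sum_le_sum fun u _ => sum_le_sum fun v _ => (hf.1 u v).2
  simp only [← sum_add_sum_compl S, sum_sub_distrib, sum_add_distrib] at h1
  linarith

/-! ### Graphs as sums of arcs -/

/-- Tail, head and capacity of an edge. -/
abbrev Arc := ℕ × ℕ × ℕ

/-- The graph that consists of one edge. -/
def arcGraph (n : ℕ) (e : Arc) : CapGraph n :=
  fun u v => if e.1 = u ∧ e.2.1 = v then e.2.2 else 0

/-- The total capacity of the edges into a node. -/
def inCap {n : ℕ} (v : Fin n) : CapGraph n →+ ℕ where
  toFun G := ∑ u, G u v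
  map_zero' := by simp
  map_add' G H := by simp [sum_add_distrib]

/-- The total capacity of the edges out of a node. -/
def outCap {n : ℕ} (u : Fin n) : CapGraph n →+ ℕ where
  toFun G := ∑ v, G u v
  map_zero' := by simp
  map_add' G H := by simp [sum_add_distrib]

theorem inCap_arcGraph {n : ℕ} (v : Fin n) {e : Arc} (he : e.1 < n) :
    inCap v (arcGraph n e) = if e.2.1 = v then e.2.2 else 0 := by
  simp only [inCap, arcGraph, AddMonoidHom.coe_mk, ZeroHom.coe_mk]
  rw [sum_eq_single (⟨e.1, he⟩ : Fin n)]
  · simp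
  · intro u _ hu
    rw [if_neg]
    rintro ⟨h, -⟩
    exact hu (Fin.ext h.symm)
  · simp

theorem outCap_arcGraph {n : ℕ} (u : Fin n) {e : Arc} (he : e.2.1 < n) :
    outCap u (arcGraph n e) = if e.1 = u then e.2.2 else 0 := by
  simp only [outCap, arcGraph, AddMonoidHom.coe_mk, ZeroHom.coe_mk]
  rw [sum_eq_single (⟨e.2.1, he⟩ : Fin n)]
  · simp
  · intro v _ hv
    rw [if_neg]
    rintro ⟨-, h⟩
    exact hv (Fin.ext h.symm)
  · simp

-- Node sets are given by predicates on natural numbers, so that the ends of a bare triple can be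
-- tested. A triple whose ends are not node numbers adds nothing to the graph, hence an inequality.
open Classical in
theorem cutCap_arcGraph_le {n : ℕ} (χ : ℕ → Prop) (e : Arc) :
    cutCap (univ.filter fun u : Fin n => χ u) (arcGraph n e) ≤
      if χ e.1 ∧ ¬ χ e.2.1 then e.2.2 else 0 := by
  simp only [cutCap, AddMonoidHom.coe_mk, ZeroHom.coe_mk]
  by_cases h : (∃ u : Fin n, e.1 = u) ∧ ∃ v : Fin n, e.2.1 = v
  · obtain ⟨⟨u, hu⟩, v, hv⟩ := h
    split_ifs with hχ
    · calc _ ≤ ∑ x : Fin n, ∑ y : Fin n, arcGraph n e x y :=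
            (sum_le_sum fun x _ => sum_le_sum_of_subset (subset_univ _)).trans
              (sum_le_sum_of_subset (subset_univ _))
        _ = ∑ x : Fin n, outCap x (arcGraph n e) := rfl
        _ = ∑ x : Fin n, if u = x then e.2.2 else 0 := by
            refine sum_congr rfl fun x _ => ?_
            rw [outCap_arcGraph x (hv ▸ v.isLt), hu]
            simp only [Fin.ext_iff]
        _ = e.2.2 := by simp
        _ ≤ _ := le_rfl
    · refine (sum_eq_zero fun x hx => sum_eq_zero fun y hy => ?_).le
      rw [arcGraph, if_neg]
      rintro ⟨h1, h2⟩
      simp only [mem_compl, mem_filter, mem_univ, true_and] at hx hy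
      exact hχ ⟨h1 ▸ hx, h2 ▸ hy⟩
  · refine (sum_eq_zero fun x _ => sum_eq_zero fun y _ => ?_).le.trans (Nat.zero_le _)
    rw [arcGraph, if_neg]
    exact fun h' => h ⟨⟨x, h'.1⟩, y, h'.2⟩

/-- Flows are built as integral capacity graphs, so that the additive maps `inCap` and `outCap`
check conservation arc by arc. -/
theorem isFlow_of_le {n : ℕ} {F G : CapGraph n} {s t : Fin n} (hle : ∀ u v, F u v ≤ G u v)
    (hF : ∀ v, v ≠ s → v ≠ t → inCap v F = outCap v F) :
    IsFlow G s t fun u v => (F u v : ℝ) := by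
  refine ⟨fun u v => ⟨Nat.cast_nonneg _, Nat.cast_le.2 (hle u v)⟩, fun v hs ht => ?_⟩
  have := hF v hs ht
  simp only [inCap, outCap, AddMonoidHom.coe_mk, ZeroHom.coe_mk] at this
  beta_reduce
  exact_mod_cast this

/-! ### The network of a bipartite covering problem -/

/-- Two sets of `N` elements and `M` constraints, with `α x j = 1` (`β y j = 1`) if the element `x`
of the first (`y` of the second) set satisfies the constraint `j`, and `0` otherwise. -/
structure Net where
  N : ℕ
  M : ℕ
  α : ℕ → ℕ → ℕ
  β : ℕ → ℕ → ℕ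
  hN : 0 < N
  hα : ∀ x j, α x j ≤ 1
  hβ : ∀ x j, β x j ≤ 1

namespace Net

variable (H : Net)

/-- The number of nodes: `0` is the source, `1` the sink, `2 + x` and `2 + N + y` are the elements
of the two sets, three nodes from `2 + 2 * N + 3 * j` on belong to the constraint `j`, and the rest
is isolated. -/
def nodes : ℕ := 3 * H.N * (H.M + 1) + 2

/-- From the element `i / M` of the first set to the constraint `i % M`. -/
def acArc (i : ℕ) : Arc :=
  (2 + i / H.M, 2 + 2 * H.N + 3 * (i % H.M) + H.α (i / H.M) (i % H.M), H.N)

/-- From the constraint `i % M` to the element `i / M` of the second set. -/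
def cbArc (i : ℕ) : Arc :=
  (2 + 2 * H.N + 3 * (i % H.M) + 2 * H.β (i / H.M) (i % H.M), 2 + H.N + i / H.M, 1)

/-- From an element of the second set to the sink. -/
def btArc (x : ℕ) : Arc := (2 + H.N + x, 1, 1)

/-- From the source to an element of the first set. -/
def saArc (x : ℕ) : Arc := (0, 2 + x, H.N)

/-- From an element of the first set to the sink. -/
def atArc (x : ℕ) : Arc := (2 + x, 1, H.N)

/-- The edges that do not change. -/
def baseGraph : CapGraph H.nodes :=
  ∑ i ∈ range (H.N * H.M), (arcGraph H.nodes (H.acArc i) + arcGraph H.nodes (H.cbArc i)) +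
    ∑ x ∈ range H.N, arcGraph H.nodes (H.btArc x)

/-- The unchanging edges and the edges of the elements of `Q` from the source and to the sink. -/
def graph (Q : Finset ℕ) : CapGraph H.nodes :=
  H.baseGraph + ∑ x ∈ Q, (arcGraph H.nodes (H.saArc x) + arcGraph H.nodes (H.atArc x))

/-- The source. -/
def s : Fin H.nodes := ⟨0, by simp [nodes]⟩

/-- The sink. -/
def t : Fin H.nodes := ⟨1, by simp [nodes]⟩

variable {H}

theorem div_lt_of_lt {i : ℕ} (hi : i < H.N * H.M) : i / H.M < H.N :=
  Nat.div_lt_of_lt_mul (by rwa [mul_comm] at hi)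

theorem mod_lt_of_lt {i : ℕ} (hi : i < H.N * H.M) : i % H.M < H.M :=
  Nat.mod_lt _ (Nat.pos_of_ne_zero fun h => by simp [h] at hi)

theorem le_nodes : 2 + 2 * H.N + 3 * H.M ≤ H.nodes := by
  have := H.hN
  simp only [nodes]
  nlinarith

section Query

variable {Q : Finset ℕ} {x₀ : ℕ}

-- If `χ` is closed under the arcs at the constraints and avoids `Q`, only arcs from the source and
-- unit arcs into the sink can cross the cut: each element of `Q` pays at most `N` at the source,
-- `A` bounds the unit arcs, and `x₀` pays only if it lies outside.
open Classical in
theorem maxFlow_le_of_cut {y : ℕ}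
    (hy : IsMaxFlowValue (H.graph Q + arcGraph H.nodes (H.saArc x₀)) H.s H.t y)
    (χ : ℕ → Prop) (hχ0 : χ 0) (hχ1 : ¬ χ 1) (A : ℕ)
    (hac : ∀ i < H.N * H.M, χ (H.acArc i).1 → χ (H.acArc i).2.1)
    (hcb : ∀ i < H.N * H.M, χ (H.cbArc i).1 → χ (H.cbArc i).2.1)
    (hbt : ∑ x ∈ range H.N, (if χ (2 + H.N + x) then 1 else 0) ≤ A)
    (hat : ∀ x ∈ Q, ¬ χ (2 + x)) :
    y ≤ A + H.N * Q.card + if χ (2 + x₀) then 0 else H.N := by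
  obtain ⟨⟨f, hf, hfy⟩, -⟩ := hy
  have hcut := hf.value_le_cutCap (S := univ.filter fun u : Fin H.nodes => χ u)
    (by simpa [s] using hχ0) (by simpa [t] using hχ1)
  rw [hfy, Nat.cast_le] at hcut
  refine hcut.trans ?_
  simp only [graph, baseGraph, map_add, map_sum]
  have h1 : ∑ i ∈ range (H.N * H.M),
      (cutCap (univ.filter fun u : Fin H.nodes => χ u) (arcGraph H.nodes (H.acArc i)) +
       cutCap (univ.filter fun u : Fin H.nodes => χ u) (arcGraph H.nodes (H.cbArc i))) = 0 := by
    refine sum_eq_zero fun i hi => ?_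
    have hi := mem_range.1 hi
    have ha := cutCap_arcGraph_le (n := H.nodes) χ (H.acArc i)
    have hb := cutCap_arcGraph_le (n := H.nodes) χ (H.cbArc i)
    rw [if_neg (fun h => h.2 (hac i hi h.1))] at ha
    rw [if_neg (fun h => h.2 (hcb i hi h.1))] at hb
    omega
  have h2 : ∑ x ∈ range H.N,
      cutCap (univ.filter fun u : Fin H.nodes => χ u) (arcGraph H.nodes (H.btArc x)) ≤ A :=
    (sum_le_sum fun x _ => (cutCap_arcGraph_le χ (H.btArc x)).trans
      (by simp [btArc, hχ1])).trans hbt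
  have h3 : ∑ x ∈ Q,
      (cutCap (univ.filter fun u : Fin H.nodes => χ u) (arcGraph H.nodes (H.saArc x)) +
       cutCap (univ.filter fun u : Fin H.nodes => χ u) (arcGraph H.nodes (H.atArc x))) ≤
      H.N * Q.card := by
    rw [mul_comm, ← smul_eq_mul]
    refine sum_le_card_nsmul _ _ _ fun x hx => ?_
    have ha := cutCap_arcGraph_le (n := H.nodes) χ (H.saArc x)
    have hb := cutCap_arcGraph_le (n := H.nodes) χ (H.atArc x)
    rw [if_neg (fun h => hat x hx h.1)] at hb
    have : (if χ (H.saArc x).1 ∧ ¬χ (H.saArc x).2.1 then (H.saArc x).2.2 else 0) ≤ H.N := by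
      split_ifs
      · exact le_rfl
      · exact Nat.zero_le _
    omega
  have h4 := cutCap_arcGraph_le (n := H.nodes) χ (H.saArc x₀)
  have h5 : (H.saArc x₀).1 = 0 ∧ (H.saArc x₀).2.1 = 2 + x₀ ∧ (H.saArc x₀).2.2 = H.N :=
    ⟨rfl, rfl, rfl⟩
  rw [h5.1, h5.2.1, h5.2.2] at h4
  simp only [hχ0, true_and, ite_not] at h4
  omega

/-- The cut separates what is reachable from `x₀` from the rest. The element `b` is not reachable,
so at most `N - 1` unit arcs into the sink are cut. -/
theorem maxFlow_lt {y : ℕ} (hx₀ : x₀ < H.N) (hQ : x₀ ∉ Q) (hQN : ∀ x ∈ Q, x < H.N)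
    (hy : IsMaxFlowValue (H.graph Q + arcGraph H.nodes (H.saArc x₀)) H.s H.t y)
    {b : ℕ} (hb : b < H.N) (hbj : ∀ j < H.M, H.α x₀ j = 1 ∨ H.β b j = 1) :
    y < H.N * (Q.card + 1) := by
  classical
  -- The nodes `2 + 2 * N + 3 * j + 1`, heads of the arcs from elements that satisfy `j`, are dead
  -- ends: no arc leaves them, so all of them can join the set for free.
  let χ : ℕ → Prop := fun u => u = 0 ∨ u = 2 + x₀ ∨
    (∃ j < H.M, u = 2 + 2 * H.N + 3 * j ∧ H.α x₀ j = 0) ∨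
    (∃ j < H.M, u = 2 + 2 * H.N + 3 * j + 1) ∨
    (∃ z < H.N, u = 2 + H.N + z ∧ ∃ j < H.M, H.α x₀ j = 0 ∧ H.β z j = 0)
  have hχ1 : ¬ χ 1 := by
    rintro (h | h | ⟨j, -, h, -⟩ | ⟨j, -, h⟩ | ⟨z, -, h, -⟩) <;> omega
  have h2 := maxFlow_le_of_cut hy χ (Or.inl rfl) hχ1 (H.N - 1) ?_ ?_ ?_ ?_
  · rw [if_pos (Or.inr (Or.inl rfl))] at h2
    have := H.hN
    rw [mul_add]
    omega
  · intro i hi h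
    have hxN := div_lt_of_lt hi
    have hjM := mod_lt_of_lt hi
    simp only [acArc] at h ⊢
    have hx : i / H.M = x₀ := by
      generalize i / H.M = x at *
      rcases h with h | h | ⟨j, -, h, -⟩ | ⟨j, -, h⟩ | ⟨z, -, h, -⟩ <;> omega
    rw [hx]
    rcases Nat.le_one_iff_eq_zero_or_eq_one.1 (H.hα x₀ (i % H.M)) with h0 | h0
    · exact Or.inr (Or.inr (Or.inl ⟨_, hjM, by omega, h0⟩))
    · exact Or.inr (Or.inr (Or.inr (Or.inl ⟨_, hjM, by omega⟩)))
  · intro i hi h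
    have hxN := div_lt_of_lt hi
    have hjM := mod_lt_of_lt hi
    have hβ := H.hβ (i / H.M) (i % H.M)
    simp only [cbArc] at h ⊢
    rcases h with h | h | ⟨j, hj, h, hj0⟩ | ⟨j, -, h⟩ | ⟨z, hz, h, -⟩
    · omega
    · omega
    · have : j = i % H.M := by omega
      subst this
      exact Or.inr (Or.inr (Or.inr (Or.inr ⟨_, hxN, rfl, _, hjM, hj0, by omega⟩)))
    · omega
    · omega
  · rw [← add_sum_erase _ _ (mem_range.2 hb), if_neg, zero_add]
    · refine (sum_le_card_nsmul _ _ 1 fun x _ => by split_ifs <;> simp).trans ?_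
      simp [card_erase_of_mem (mem_range.2 hb)]
    · intro h
      rcases h with h | h | ⟨j, -, h, -⟩ | ⟨j, -, h⟩ | ⟨z, -, h, j, hj, hj0, hz0⟩
      · omega
      · omega
      · omega
      · omega
      · have : z = b := by omega
        subst this
        rcases hbj j hj with h' | h' <;> omega
  · rintro x hx (h | h | ⟨j, -, h, -⟩ | ⟨j, -, h⟩ | ⟨z, -, h, -⟩)
    · omega
    · exact hQ (by rwa [show x = x₀ by omega] at hx)
    all_goals have := hQN x hx; omega

/-- Every `b` receives one unit from `x₀` through a constraint `J b` that both fail, and every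
element of `Q` sends its `N` units directly to the sink. -/
theorem le_maxFlow {y : ℕ} (hx₀ : x₀ < H.N) (hQN : ∀ x ∈ Q, x < H.N)
    (hy : IsMaxFlowValue (H.graph Q + arcGraph H.nodes (H.saArc x₀)) H.s H.t y)
    (hbj : ∀ b < H.N, ∃ j < H.M, H.α x₀ j = 0 ∧ H.β b j = 0) :
    H.N * (Q.card + 1) ≤ y := by
  choose! J hJ hαJ hβJ using hbj
  have hn := le_nodes (H := H)
  let c : ℕ → ℕ := fun b => 2 + 2 * H.N + 3 * J b
  let A : Arc → CapGraph H.nodes := arcGraph H.nodes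
  let F : CapGraph H.nodes := ∑ x ∈ Q, (A (H.saArc x) + A (H.atArc x)) +
    ∑ b ∈ range H.N, (A (0, 2 + x₀, 1) + A (2 + x₀, c b, 1) + A (c b, 2 + H.N + b, 1) +
      A (2 + H.N + b, 1, 1))
  have hle : ∀ u v, F u v ≤ (H.graph Q + arcGraph H.nodes (H.saArc x₀)) u v := by
    have hac : ∀ b < H.N, H.acArc (x₀ * H.M + J b) = (2 + x₀, c b, H.N) := by
      intro b hb
      have h1 : (x₀ * H.M + J b) / H.M = x₀ := by
        rw [add_comm, Nat.add_mul_div_right _ _ (Nat.zero_lt_of_lt (hJ b hb)),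
          Nat.div_eq_of_lt (hJ b hb), zero_add]
      have h2 : (x₀ * H.M + J b) % H.M = J b := by
        rw [add_comm, Nat.add_mul_mod_self_right, Nat.mod_eq_of_lt (hJ b hb)]
      simp only [acArc, h1, h2, hαJ b hb, c, add_zero]
    have hcb : ∀ b < H.N, H.cbArc (b * H.M + J b) = (c b, 2 + H.N + b, 1) := by
      intro b hb
      have h1 : (b * H.M + J b) / H.M = b := by
        rw [add_comm, Nat.add_mul_div_right _ _ (Nat.zero_lt_of_lt (hJ b hb)),
          Nat.div_eq_of_lt (hJ b hb), zero_add]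
      have h2 : (b * H.M + J b) % H.M = J b := by
        rw [add_comm, Nat.add_mul_mod_self_right, Nat.mod_eq_of_lt (hJ b hb)]
      simp only [cbArc, h1, h2, hβJ b hb, c, mul_zero, add_zero]
    have hlt : ∀ z < H.N, ∀ b < H.N, z * H.M + J b < H.N * H.M := by
      intro z hz b hb
      have := hJ b hb
      nlinarith
    intro u v
    simp only [F, graph, baseGraph, Pi.add_apply, Finset.sum_apply, sum_add_distrib]
    have e1 : ∑ _b ∈ range H.N, A (0, 2 + x₀, 1) u v = arcGraph H.nodes (H.saArc x₀) u v := by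
      rw [show H.saArc x₀ = (0, 2 + x₀, H.N) from rfl]
      simp only [A, arcGraph, sum_const, card_range, smul_eq_mul]
      by_cases h : 0 = (u : ℕ) ∧ 2 + x₀ = (v : ℕ)
      · rw [if_pos h, if_pos h, mul_one]
      · rw [if_neg h, if_neg h, mul_zero]
    -- Many `b` may share a constraint; this is why the arcs into constraints have capacity `N`.
    have e2 : ∑ b ∈ range H.N, A (2 + x₀, c b, 1) u v ≤
        ∑ i ∈ range (H.N * H.M), arcGraph H.nodes (H.acArc i) u v := by
      by_cases hall : ∃ b < H.N, 2 + x₀ = u ∧ c b = v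
      · obtain ⟨b, hb, hu, hv⟩ := hall
        refine le_trans ?_ (single_le_sum (fun _ _ => Nat.zero_le _)
          (mem_range.2 (hlt x₀ hx₀ b hb)))
        rw [hac b hb, arcGraph, if_pos ⟨hu, hv⟩]
        refine (sum_le_card_nsmul _ _ 1 fun x _ => ?_).trans (by simp)
        simp only [A, arcGraph]
        split_ifs <;> simp
      · refine (sum_eq_zero fun b hb => ?_).le.trans (Nat.zero_le _)
        simp only [A, arcGraph]
        exact if_neg fun h => hall ⟨b, mem_range.1 hb, h⟩
    -- The head determines `b`, so at most one path uses a given arc and capacity `1` suffices.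
    have e3 : ∑ b ∈ range H.N, A (c b, 2 + H.N + b, 1) u v ≤
        ∑ i ∈ range (H.N * H.M), arcGraph H.nodes (H.cbArc i) u v := by
      by_cases hall : ∃ b < H.N, c b = u ∧ 2 + H.N + b = v
      · obtain ⟨b, hb, hu, hv⟩ := hall
        refine le_trans ?_ (single_le_sum (fun _ _ => Nat.zero_le _)
          (mem_range.2 (hlt b hb b hb)))
        rw [hcb b hb, arcGraph, if_pos ⟨hu, hv⟩, sum_eq_single_of_mem b (mem_range.2 hb)]
        · simp only [A, arcGraph]
          split_ifs <;> simp
        · intro b' _ hb'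
          simp only [A, arcGraph]
          exact if_neg fun h => hb' (by omega)
      · refine (sum_eq_zero fun b hb => ?_).le.trans (Nat.zero_le _)
        simp only [A, arcGraph]
        exact if_neg fun h => hall ⟨b, mem_range.1 hb, h⟩
    have e4 : ∑ b ∈ range H.N, A (2 + H.N + b, 1, 1) u v =
        ∑ b ∈ range H.N, arcGraph H.nodes (H.btArc b) u v := rfl
    simp only [A] at e1 e2 e3 e4 ⊢
    omega
  have hin : ∀ v, inCap v F = ∑ x ∈ Q, ((if 2 + x = (v : ℕ) then H.N else 0) +
      (if 1 = (v : ℕ) then H.N else 0)) +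
      ∑ b ∈ range H.N, ((if 2 + x₀ = (v : ℕ) then 1 else 0) + (if c b = v then 1 else 0) +
        (if 2 + H.N + b = v then 1 else 0) + (if 1 = (v : ℕ) then 1 else 0)) := by
    intro v
    simp only [F, A, map_add, map_sum]
    congr 1
    · refine sum_congr rfl fun x hx => ?_
      have := hQN x hx
      rw [inCap_arcGraph, inCap_arcGraph]
      · rfl
      · simp only [atArc]; omega
      · simp only [saArc]; omega
    · refine sum_congr rfl fun b hb => ?_
      have hb := mem_range.1 hb
      have := hJ b hb
      rw [inCap_arcGraph, inCap_arcGraph, inCap_arcGraph, inCap_arcGraph]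
      all_goals simp only [c]; omega
  have hout : ∀ v, outCap v F = ∑ x ∈ Q, ((if 0 = (v : ℕ) then H.N else 0) +
      (if 2 + x = (v : ℕ) then H.N else 0)) +
      ∑ b ∈ range H.N, ((if 0 = (v : ℕ) then 1 else 0) + (if 2 + x₀ = (v : ℕ) then 1 else 0) +
        (if c b = v then 1 else 0) + (if 2 + H.N + b = v then 1 else 0)) := by
    intro v
    simp only [F, A, map_add, map_sum]
    congr 1
    · refine sum_congr rfl fun x hx => ?_
      have := hQN x hx
      rw [outCap_arcGraph, outCap_arcGraph]
      · rfl
      · simp only [atArc]; omega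
      · simp only [saArc]; omega
    · refine sum_congr rfl fun b hb => ?_
      have hb := mem_range.1 hb
      have := hJ b hb
      rw [outCap_arcGraph, outCap_arcGraph, outCap_arcGraph, outCap_arcGraph]
      all_goals simp only [c]; omega
  have hflow : IsFlow (H.graph Q + arcGraph H.nodes (H.saArc x₀)) H.s H.t
      fun u v => (F u v : ℝ) := by
    refine isFlow_of_le hle fun v hs ht => ?_
    have h0 : 0 ≠ (v : ℕ) := fun h => hs (Fin.ext h.symm)
    have h1 : 1 ≠ (v : ℕ) := fun h => ht (Fin.ext h.symm)
    rw [hin, hout]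
    simp only [h0, h1, if_false, zero_add, add_zero]
  have hval : flowValue H.s (fun u v => (F u v : ℝ)) = ((H.N * (Q.card + 1) : ℕ) : ℝ) := by
    have ho : outCap H.s F = H.N * (Q.card + 1) := by
      rw [hout]
      simp [s, c]
      ring
    have hi : inCap H.s F = 0 := by
      rw [hin]
      simp [s, c]
    simp only [inCap, outCap, AddMonoidHom.coe_mk, ZeroHom.coe_mk] at ho hi
    rw [flowValue, ← Nat.cast_sum, ← Nat.cast_sum, ho, hi]
    simp
  exact_mod_cast hy.2 ⟨_, hflow, hval⟩

/-- The maximum flow is smaller than the capacity of the edges at the source if and only if some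
element of the second set satisfies all constraints that `x₀` does not satisfy. -/
theorem maxFlow_lt_iff {y : ℕ} (hx₀ : x₀ < H.N) (hQ : x₀ ∉ Q) (hQN : ∀ x ∈ Q, x < H.N)
    (hy : IsMaxFlowValue (H.graph Q + arcGraph H.nodes (H.saArc x₀)) H.s H.t y) :
    y < H.N * (Q.card + 1) ↔ ∃ b < H.N, ∀ j < H.M, H.α x₀ j = 1 ∨ H.β b j = 1 := by
  constructor
  · intro h
    by_contra! hcon
    refine h.not_ge (le_maxFlow hx₀ hQN hy fun b hb => ?_)
    obtain ⟨j, hj, h1, h2⟩ := hcon b hb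
    have := H.hα x₀ j
    have := H.hβ b j
    exact ⟨j, hj, by omega, by omega⟩
  · rintro ⟨b, hb, hbj⟩
    exact maxFlow_lt hx₀ hQ hQN hy hb hbj

end Query

end Net

end DynFlow

/-! ### The network as a legal sequence of edge updates. -/

namespace DynFlow

open Finset

/-- Tail and head of an arc. -/
def Arc.key (e : Arc) : ℕ × ℕ := (e.1, e.2.1)

namespace Net

variable (H : Net)

theorem nodes_pos : 0 < H.nodes := by simp [nodes]

/-- The node with a given number. -/
def node (u : ℕ) : Fin H.nodes := ⟨u % H.nodes, Nat.mod_lt _ H.nodes_pos⟩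

/-- The arc as an edge between nodes. -/
def edge (e : Arc) : Fin H.nodes × Fin H.nodes × ℕ := (H.node e.1, H.node e.2.1, e.2.2)

/-- The insertion (deletion) of an arc. -/
def updateOp (mode : Mode) (e : Arc) : Op H.nodes :=
  match mode with
  | .incremental => .insert (H.node e.1) (H.node e.2.1) e.2.2
  | .decremental => .delete (H.node e.1) (H.node e.2.1)

/-- The graph with a list of arcs. -/
def listGraph (L : List Arc) : CapGraph H.nodes := (L.map (arcGraph H.nodes)).sum

/-- The arc is admissible as an edge of the graph. -/
structure Good (e : Arc) : Prop where
  tail : e.1 < H.nodes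
  head : e.2.1 < H.nodes
  ne : e.1 ≠ e.2.1
  pos : 0 < e.2.2
  le : e.2.2 ≤ H.N

variable {H}

theorem node_val {u : ℕ} (hu : u < H.nodes) : (H.node u : ℕ) = u := Nat.mod_eq_of_lt hu

theorem arcGraph_node {u v : ℕ} (hu : u < H.nodes) (hv : v < H.nodes) (e : Arc) :
    arcGraph H.nodes e (H.node u) (H.node v) = if e.key = (u, v) then e.2.2 else 0 := by
  simp only [arcGraph, node_val hu, node_val hv, Arc.key, Prod.mk.injEq]

theorem setCap_add {G : CapGraph H.nodes} {e : Arc} (h1 : e.1 < H.nodes) (h2 : e.2.1 < H.nodes)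
    (hG : G (H.node e.1) (H.node e.2.1) = 0) :
    G.setCap (H.node e.1) (H.node e.2.1) e.2.2 = G + arcGraph H.nodes e := by
  funext u v
  simp only [CapGraph.setCap, Pi.add_apply, arcGraph, Fin.ext_iff, node_val h1, node_val h2]
  by_cases h : (u : ℕ) = e.1 ∧ (v : ℕ) = e.2.1
  · have hu : u = H.node e.1 := Fin.ext (by rw [node_val h1, h.1])
    have hv : v = H.node e.2.1 := Fin.ext (by rw [node_val h2, h.2])
    rw [if_pos h, if_pos ⟨h.1.symm, h.2.symm⟩, hu, hv, hG, zero_add]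
  · rw [if_neg h, if_neg fun h' => h ⟨h'.1.symm, h'.2.symm⟩, add_zero]

theorem setCap_zero {G : CapGraph H.nodes} {e : Arc} (h1 : e.1 < H.nodes) (h2 : e.2.1 < H.nodes)
    (hG : G (H.node e.1) (H.node e.2.1) = 0) :
    (G + arcGraph H.nodes e).setCap (H.node e.1) (H.node e.2.1) 0 = G := by
  rw [← setCap_add h1 h2 hG]
  funext u v
  simp only [CapGraph.setCap]
  split_ifs with h
  · rw [h.1, h.2, hG]
  · rfl

theorem listGraph_eq_zero {L : List Arc} {e : Arc} (h1 : e.1 < H.nodes) (h2 : e.2.1 < H.nodes)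
    (h : e.key ∉ L.map Arc.key) : H.listGraph L (H.node e.1) (H.node e.2.1) = 0 := by
  induction L with
  | nil => simp [listGraph]
  | cons a L ih =>
    simp only [List.map_cons, List.mem_cons, not_or] at h
    simp only [listGraph, List.map_cons, List.sum_cons, Pi.add_apply] at ih ⊢
    rw [ih h.2, arcGraph_node h1 h2, if_neg fun h' => h.1 (by rw [h']; rfl)]

theorem listGraph_append (L L' : List Arc) :
    H.listGraph (L ++ L') = H.listGraph L + H.listGraph L' := by
  simp [listGraph]

theorem numEdges_listGraph_le (L : List Arc) : (H.listGraph L).numEdges ≤ L.length := by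
  have hsub : (univ.filter fun e : Fin H.nodes × Fin H.nodes => 0 < H.listGraph L e.1 e.2) ⊆
      (L.map fun e => (H.node e.1, H.node e.2.1)).toFinset := by
    intro p hp
    simp only [mem_filter, mem_univ, true_and] at hp
    by_contra hcon
    simp only [List.mem_toFinset, List.mem_map, not_exists, not_and] at hcon
    refine hp.ne' ?_
    rw [listGraph]
    clear hp
    induction L with
    | nil => simp
    | cons a L ih =>
      simp only [List.map_cons, List.sum_cons, Pi.add_apply]
      rw [ih fun e he => hcon e (List.mem_cons_of_mem _ he), arcGraph, if_neg]
      rintro ⟨h1, h2⟩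
      refine hcon a List.mem_cons_self (Prod.ext (Fin.ext ?_) (Fin.ext ?_))
      · simp only [node, h1, Nat.mod_eq_of_lt p.1.isLt]
      · simp only [node, h2, Nat.mod_eq_of_lt p.2.isLt]
  refine (card_le_card hsub).trans ((List.toFinset_card_le _).trans ?_)
  simp

theorem apply_listGraph {D : List Arc} {e : Arc} (he : H.Good e) (h : e.key ∉ D.map Arc.key) :
    (H.updateOp .incremental e).apply (H.listGraph D) = H.listGraph (D ++ [e]) := by
  rw [updateOp, Op.apply, setCap_add he.tail he.head (listGraph_eq_zero he.tail he.head h),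
    listGraph_append]
  simp [listGraph]

/-- An insertion overwrites a capacity, whereas the network is a sum of arcs. The two agree because
the keys are pairwise distinct, so a pair is still empty when its arc arrives. -/
theorem foldl_inserts (L : List Arc) : ∀ {D : List Arc}, (∀ e ∈ L, H.Good e) →
    ((D ++ L).map Arc.key).Nodup →
    (L.map (H.updateOp .incremental)).foldl Op.apply (H.listGraph D) = H.listGraph (D ++ L) := by
  induction L with
  | nil => simp
  | cons e L ih =>
    intro D hL hD
    have he : e.key ∉ D.map Arc.key := by
      rw [List.map_append, List.nodup_append] at hD
      exact fun h => hD.2.2 _ h _ (List.mem_map_of_mem List.mem_cons_self) rfl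
    rw [List.map_cons, List.foldl_cons, apply_listGraph (hL e List.mem_cons_self) he,
      ih (fun e' he' => hL e' (List.mem_cons_of_mem _ he')) (by simpa using hD)]
    simp

theorem legalOps_inserts {rest : List (Op H.nodes)} (L : List Arc) : ∀ {D : List Arc},
    (∀ e ∈ L, H.Good e) → ((D ++ L).map Arc.key).Nodup →
    LegalOps .incremental (H.listGraph (D ++ L)) rest →
    LegalOps .incremental (H.listGraph D) (L.map (H.updateOp .incremental) ++ rest) := by
  induction L with
  | nil => simp
  | cons e L ih =>
    intro D hL hD hrest
    have he : e.key ∉ D.map Arc.key := by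
      rw [List.map_append, List.nodup_append] at hD
      exact fun h => hD.2.2 _ h _ (List.mem_map_of_mem List.mem_cons_self) rfl
    have hg := hL e List.mem_cons_self
    refine ⟨⟨rfl, fun h => hg.ne ?_, listGraph_eq_zero hg.tail hg.head he, hg.pos⟩, ?_⟩
    · rw [← node_val hg.tail, h, node_val hg.head]
    · rw [apply_listGraph hg he]
      exact ih (fun e' he' => hL e' (List.mem_cons_of_mem _ he')) (by simpa using hD)
        (by simpa using hrest)

/-! ### The arcs in the order in which they are produced -/

variable (H)

/-- The arcs at the constraints. -/
def mainArcs : ℕ → List Arc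
  | 0 => []
  | i + 1 => H.acArc i :: H.cbArc i :: mainArcs i

/-- The arcs from the second set to the sink. -/
def btArcs : ℕ → List Arc
  | 0 => []
  | i + 1 => H.btArc i :: btArcs i

/-- The arcs from the source and to the sink at the elements of the first set. -/
def stArcs : ℕ → List Arc
  | 0 => []
  | i + 1 => H.saArc i :: H.atArc i :: stArcs i

/-- The arcs of the unchanging edges. -/
def baseArcs : List Arc := H.mainArcs (H.N * H.M) ++ H.btArcs H.N

/-- All arcs. -/
def allArcs : List Arc := H.baseArcs ++ H.stArcs H.N

variable {H}

theorem mem_mainArcs {k : ℕ} {e : Arc} :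
    e ∈ H.mainArcs k ↔ ∃ i < k, e = H.acArc i ∨ e = H.cbArc i := by
  induction k with
  | zero => simp [mainArcs]
  | succ k ih =>
    simp only [mainArcs, List.mem_cons, ih, Nat.exists_lt_succ_right]
    rw [← or_assoc, or_comm]

theorem mem_btArcs {k : ℕ} {e : Arc} : e ∈ H.btArcs k ↔ ∃ i < k, e = H.btArc i := by
  induction k with
  | zero => simp [btArcs]
  | succ k ih => simp only [btArcs, List.mem_cons, ih, Nat.exists_lt_succ_right]; rw [or_comm]

theorem mem_stArcs {k : ℕ} {e : Arc} :
    e ∈ H.stArcs k ↔ ∃ i < k, e = H.saArc i ∨ e = H.atArc i := by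
  induction k with
  | zero => simp [stArcs]
  | succ k ih =>
    simp only [stArcs, List.mem_cons, ih, Nat.exists_lt_succ_right]
    rw [← or_assoc, or_comm]

theorem length_mainArcs (k : ℕ) : (H.mainArcs k).length = 2 * k := by
  induction k with
  | zero => rfl
  | succ k ih => simp only [mainArcs, List.length_cons, ih]; omega

theorem length_btArcs (k : ℕ) : (H.btArcs k).length = k := by
  induction k with
  | zero => rfl
  | succ k ih => simp only [btArcs, List.length_cons, ih]

theorem length_stArcs (k : ℕ) : (H.stArcs k).length = 2 * k := by
  induction k with
  | zero => rfl
  | succ k ih => simp only [stArcs, List.length_cons, ih]; omega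

theorem good_acArc {i : ℕ} (hi : i < H.N * H.M) : H.Good (H.acArc i) := by
  have h1 := div_lt_of_lt hi
  have h2 := mod_lt_of_lt hi
  have h3 := le_nodes (H := H)
  have h4 := H.hα (i / H.M) (i % H.M)
  have h5 := H.hN
  simp only [acArc]
  generalize i / H.M = x at *
  generalize i % H.M = j at *
  constructor <;> dsimp only <;> omega

theorem good_cbArc {i : ℕ} (hi : i < H.N * H.M) : H.Good (H.cbArc i) := by
  have h1 := div_lt_of_lt hi
  have h2 := mod_lt_of_lt hi
  have h3 := le_nodes (H := H)
  have h4 := H.hβ (i / H.M) (i % H.M)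
  have h5 := H.hN
  simp only [cbArc]
  generalize i / H.M = x at *
  generalize i % H.M = j at *
  constructor <;> dsimp only <;> omega

theorem good_btArc {x : ℕ} (hx : x < H.N) : H.Good (H.btArc x) := by
  have h3 := le_nodes (H := H)
  constructor <;> simp only [btArc] <;> omega

theorem good_saArc {x : ℕ} (hx : x < H.N) : H.Good (H.saArc x) := by
  have h3 := le_nodes (H := H)
  constructor <;> simp only [saArc] <;> omega

theorem good_atArc {x : ℕ} (hx : x < H.N) : H.Good (H.atArc x) := by
  have h3 := le_nodes (H := H)
  constructor <;> simp only [atArc] <;> omega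

theorem good_of_mem_baseArcs {e : Arc} (he : e ∈ H.baseArcs) : H.Good e := by
  rcases List.mem_append.1 he with h | h
  · obtain ⟨i, hi, rfl | rfl⟩ := mem_mainArcs.1 h
    · exact good_acArc hi
    · exact good_cbArc hi
  · obtain ⟨i, hi, rfl⟩ := mem_btArcs.1 h
    exact good_btArc hi

theorem good_of_mem_allArcs {e : Arc} (he : e ∈ H.allArcs) : H.Good e := by
  rcases List.mem_append.1 he with h | h
  · exact good_of_mem_baseArcs h
  · obtain ⟨i, hi, rfl | rfl⟩ := mem_stArcs.1 h
    · exact good_saArc hi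
    · exact good_atArc hi

theorem eq_of_div_eq_of_mod_eq {m i i' : ℕ} (h1 : i / m = i' / m) (h2 : i % m = i' % m) :
    i = i' := by
  rw [← Nat.div_add_mod i m, h1, h2, Nat.div_add_mod]

/-- With three nodes per constraint, a node number reveals both the constraint and the bit. Every
pair of an element and a constraint has an arc, whose bit only selects a real or a dummy node; hence
the number of arcs does not depend on the literals and the arcs can be generated without branching.
-/
theorem acArc_key_inj {i i' : ℕ} (h : (H.acArc i).key = (H.acArc i').key) : i = i' := by
  simp only [acArc, Arc.key, Prod.mk.injEq] at h
  have h1 := H.hα (i / H.M) (i % H.M)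
  have h2 := H.hα (i' / H.M) (i' % H.M)
  refine eq_of_div_eq_of_mod_eq (m := H.M) (by omega) ?_
  generalize i % H.M = j at *
  generalize i' % H.M = j' at *
  omega

theorem cbArc_key_inj {i i' : ℕ} (h : (H.cbArc i).key = (H.cbArc i').key) : i = i' := by
  simp only [cbArc, Arc.key, Prod.mk.injEq] at h
  have h1 := H.hβ (i / H.M) (i % H.M)
  have h2 := H.hβ (i' / H.M) (i' % H.M)
  refine eq_of_div_eq_of_mod_eq (m := H.M) (by omega) ?_
  generalize i % H.M = j at *
  generalize i' % H.M = j' at *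
  omega

theorem acArc_key_ne_cbArc_key {i i' : ℕ} (hi' : i' < H.N * H.M) :
    (H.acArc i).key ≠ (H.cbArc i').key := by
  have h1 := div_lt_of_lt hi'
  simp only [acArc, cbArc, Arc.key, ne_eq, Prod.mk.injEq]
  generalize i' / H.M = x at *
  omega

theorem nodup_mainArcs {k : ℕ} (hk : k ≤ H.N * H.M) : ((H.mainArcs k).map Arc.key).Nodup := by
  induction k with
  | zero => simp [mainArcs]
  | succ k ih =>
    simp only [mainArcs, List.map_cons, List.nodup_cons, List.mem_cons, List.mem_map, mem_mainArcs,
      not_or, not_exists, not_and]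
    refine ⟨⟨acArc_key_ne_cbArc_key (by omega), ?_⟩, ?_, ih (by omega)⟩
    · rintro _ ⟨i, hi, rfl | rfl⟩ h
      · have := acArc_key_inj h; omega
      · exact acArc_key_ne_cbArc_key (by omega) h.symm
    · rintro _ ⟨i, hi, rfl | rfl⟩ h
      · exact acArc_key_ne_cbArc_key (by omega) h
      · have := cbArc_key_inj h; omega

theorem nodup_allArcs : (H.allArcs.map Arc.key).Nodup := by
  have hbt : ∀ k, ((H.btArcs k).map Arc.key).Nodup := by
    intro k
    induction k with
    | zero => simp [btArcs]
    | succ k ih =>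
      simp only [btArcs, List.map_cons, List.nodup_cons, List.mem_map, mem_btArcs, not_exists,
        not_and]
      refine ⟨?_, ih⟩
      rintro _ ⟨i, hi, rfl⟩ h
      simp only [btArc, Arc.key, Prod.mk.injEq] at h
      omega
  have hst : ∀ k, ((H.stArcs k).map Arc.key).Nodup := by
    intro k
    induction k with
    | zero => simp [stArcs]
    | succ k ih =>
      simp only [stArcs, List.map_cons, List.nodup_cons, List.mem_cons, List.mem_map, mem_stArcs,
        not_or, not_exists, not_and]
      refine ⟨⟨by simp only [saArc, atArc, Arc.key, Prod.mk.injEq]; omega, ?_⟩, ?_, ih⟩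
      · rintro _ ⟨i, hi, rfl | rfl⟩ h <;> simp only [saArc, atArc, Arc.key, Prod.mk.injEq] at h <;>
          omega
      · rintro _ ⟨i, hi, rfl | rfl⟩ h <;> simp only [saArc, atArc, Arc.key, Prod.mk.injEq] at h <;>
          omega
  rw [allArcs, baseArcs, List.map_append, List.map_append, List.nodup_append, List.nodup_append]
  refine ⟨⟨nodup_mainArcs le_rfl, hbt _, ?_⟩, hst _, ?_⟩
  · rintro _ ha _ hb rfl
    obtain ⟨e, he, hek⟩ := List.mem_map.1 ha
    obtain ⟨e', he', hek'⟩ := List.mem_map.1 hb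
    obtain ⟨i', hi', rfl⟩ := mem_btArcs.1 he'
    obtain ⟨i, hi, rfl | rfl⟩ := mem_mainArcs.1 he <;> rw [← hek'] at hek <;>
      simp only [acArc, cbArc, btArc, Arc.key, Prod.mk.injEq] at hek <;> omega
  · rintro _ ha _ hb rfl
    obtain ⟨e', he', hek'⟩ := List.mem_map.1 hb
    rcases List.mem_append.1 ha with ha | ha
    · obtain ⟨e, he, hek⟩ := List.mem_map.1 ha
      rw [← hek'] at hek
      obtain ⟨i, hi, rfl | rfl⟩ := mem_mainArcs.1 he <;>
      obtain ⟨i', hi', rfl | rfl⟩ := mem_stArcs.1 he' <;>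
      simp only [acArc, cbArc, saArc, atArc, Arc.key, Prod.mk.injEq] at hek <;> omega
    · obtain ⟨e, he, hek⟩ := List.mem_map.1 ha
      rw [← hek'] at hek
      obtain ⟨i, hi, rfl⟩ := mem_btArcs.1 he
      obtain ⟨i', hi', rfl | rfl⟩ := mem_stArcs.1 he' <;>
      simp only [btArc, saArc, atArc, Arc.key, Prod.mk.injEq] at hek <;> omega

theorem nodup_baseArcs : (H.baseArcs.map Arc.key).Nodup := by
  have := nodup_allArcs (H := H)
  rw [allArcs, List.map_append, List.nodup_append] at this
  exact this.1

theorem listGraph_baseArcs : H.listGraph H.baseArcs = H.graph ∅ := by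
  have h1 : ∀ k, H.listGraph (H.mainArcs k) =
      ∑ i ∈ range k, (arcGraph H.nodes (H.acArc i) + arcGraph H.nodes (H.cbArc i)) := by
    intro k
    induction k with
    | zero => simp [listGraph, mainArcs]
    | succ k ih =>
      rw [sum_range_succ, ← ih]
      simp only [listGraph, mainArcs, List.map_cons, List.sum_cons]
      abel
  have h2 : ∀ k, H.listGraph (H.btArcs k) = ∑ i ∈ range k, arcGraph H.nodes (H.btArc i) := by
    intro k
    induction k with
    | zero => simp [listGraph, btArcs]
    | succ k ih =>
      rw [sum_range_succ, ← ih]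
      simp only [listGraph, btArcs, List.map_cons, List.sum_cons]
      abel
  rw [baseArcs, listGraph_append, h1, h2, graph, sum_empty, add_zero, baseGraph]

theorem listGraph_allArcs : H.listGraph H.allArcs = H.graph (range H.N) := by
  have h1 : ∀ k, H.listGraph (H.stArcs k) =
      ∑ i ∈ range k, (arcGraph H.nodes (H.saArc i) + arcGraph H.nodes (H.atArc i)) := by
    intro k
    induction k with
    | zero => simp [listGraph, stArcs]
    | succ k ih =>
      rw [sum_range_succ, ← ih]
      simp only [listGraph, stArcs, List.map_cons, List.sum_cons]
      abel
  rw [allArcs, listGraph_append, listGraph_baseArcs, h1, graph, graph, sum_empty, add_zero]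

/-! ### The phases -/

variable (H)

/-- The first update of the phase of an element of the first set. -/
def firstArc (mode : Mode) (x : ℕ) : Arc :=
  match mode with
  | .incremental => (0, 2 + x, H.N)
  | .decremental => (2 + x, 1, 0)

/-- The second update of the phase of an element of the first set. -/
def secondArc (mode : Mode) (x : ℕ) : Arc :=
  match mode with
  | .incremental => (2 + x, 1, H.N)
  | .decremental => (0, 2 + x, 0)

/-- The operations of the phases of the elements smaller than a number, in decreasing order. -/
def phaseOps (mode : Mode) : ℕ → List (Op H.nodes)
  | 0 => []
  | i + 1 => H.updateOp mode (H.firstArc mode i) :: .query ::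
      H.updateOp mode (H.secondArc mode i) :: phaseOps mode i

/-- The elements with edges from the source and to the sink when the phases of the elements
smaller than a number are left. -/
def linked (mode : Mode) (i : ℕ) : Finset ℕ :=
  match mode with
  | .incremental => Ico i H.N
  | .decremental => range i

/-- The other elements with edges from the source and to the sink at the query for an element. -/
def others (mode : Mode) (i : ℕ) : Finset ℕ :=
  match mode with
  | .incremental => Ico (i + 1) H.N
  | .decremental => range i

variable {H}

theorem graph_saArc {Q : Finset ℕ} {x : ℕ} (hx : x < H.N) (hQ : x ∉ Q) :
    H.graph Q (H.node (H.saArc x).1) (H.node (H.saArc x).2.1) = 0 := by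
  have hg := good_saArc hx
  simp only [graph, baseGraph, Pi.add_apply, Finset.sum_apply, arcGraph_node hg.tail hg.head]
  simp only [acArc, cbArc, btArc, saArc, atArc, Arc.key, Prod.mk.injEq]
  simp only [Nat.add_eq_zero_iff, OfNat.ofNat_ne_zero, false_and, if_false, true_and,
    sum_const_zero, zero_add, add_zero]
  refine sum_eq_zero fun y hy => if_neg fun h => hQ ?_
  rwa [show x = y by omega]

theorem graph_add_atArc {Q : Finset ℕ} {x : ℕ} (hx : x < H.N) (hQ : x ∉ Q) :
    (H.graph Q + arcGraph H.nodes (H.saArc x)) (H.node (H.atArc x).1) (H.node (H.atArc x).2.1) =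
      0 := by
  have hg := good_atArc hx
  simp only [graph, baseGraph, Pi.add_apply, Finset.sum_apply, arcGraph_node hg.tail hg.head]
  simp only [acArc, cbArc, btArc, saArc, atArc, Arc.key, Prod.mk.injEq]
  rw [if_neg (by omega), add_zero, sum_eq_zero, sum_eq_zero, sum_eq_zero]
  · rfl
  · intro y hy
    rw [if_neg (by omega), if_neg, add_zero]
    rintro ⟨h, -⟩
    exact hQ (by rwa [show x = y by omega])
  · exact fun y hy => if_neg (by omega)
  · intro i _
    rw [if_neg (by omega), if_neg (by omega), add_zero]

theorem graph_insert {Q : Finset ℕ} {x : ℕ} (hQ : x ∉ Q) :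
    H.graph Q + arcGraph H.nodes (H.saArc x) + arcGraph H.nodes (H.atArc x) =
      H.graph (insert x Q) := by
  rw [graph, graph, sum_insert hQ]
  abel

variable {mode : Mode} {i : ℕ}

theorem notMem_others : i ∉ H.others mode i := by cases mode <;> simp [others]

theorem lt_of_mem_others (hi : i < H.N) {x : ℕ} (hx : x ∈ H.others mode i) : x < H.N := by
  cases mode <;> simp only [others, mem_Ico, mem_range] at hx <;> omega

/-- Both modes pass through a graph of the same shape at a query: the element `i` has its arc from
the source but not yet, or no longer, its arc to the sink. One analysis of the query thus serves
both. -/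
theorem apply_firstArc (hi : i < H.N) :
    (H.updateOp mode (H.firstArc mode i)).apply (H.graph (H.linked mode (i + 1))) =
      H.graph (H.others mode i) + arcGraph H.nodes (H.saArc i) := by
  have hQ := notMem_others (H := H) (mode := mode) (i := i)
  cases mode with
  | incremental =>
    exact setCap_add (good_saArc hi).tail (good_saArc hi).head (graph_saArc hi hQ)
  | decremental =>
    have : H.linked .decremental (i + 1) = insert i (H.others .decremental i) :=
      range_add_one
    rw [this, ← graph_insert hQ]
    exact setCap_zero (good_atArc hi).tail (good_atArc hi).head (graph_add_atArc hi hQ)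

theorem apply_secondArc (hi : i < H.N) :
    (H.updateOp mode (H.secondArc mode i)).apply
      (H.graph (H.others mode i) + arcGraph H.nodes (H.saArc i)) =
      H.graph (H.linked mode i) := by
  have hQ := notMem_others (H := H) (mode := mode) (i := i)
  cases mode with
  | incremental =>
    have : H.linked .incremental i = insert i (H.others .incremental i) := by
      ext x
      simp only [linked, others, mem_insert, mem_Ico]
      omega
    rw [this, ← graph_insert hQ]
    exact setCap_add (good_atArc hi).tail (good_atArc hi).head (graph_add_atArc hi hQ)
  | decremental =>
    exact setCap_zero (good_saArc hi).tail (good_saArc hi).head (graph_saArc hi hQ)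

theorem legal_firstArc (hi : i < H.N) :
    (H.updateOp mode (H.firstArc mode i)).Legal mode (H.graph (H.linked mode (i + 1))) := by
  have hQ := notMem_others (H := H) (mode := mode) (i := i)
  cases mode with
  | incremental =>
    have hg := good_saArc hi
    refine ⟨rfl, fun h => hg.ne ?_, graph_saArc hi hQ, hg.pos⟩
    rw [← node_val hg.tail, ← node_val hg.head]
    exact congrArg _ h
  | decremental =>
    have hg := good_atArc hi
    have : H.linked .decremental (i + 1) = insert i (H.others .decremental i) :=
      range_add_one
    refine ⟨rfl, ?_⟩
    rw [this, ← graph_insert hQ, Pi.add_apply, Pi.add_apply]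
    refine Nat.add_pos_right _ ?_
    exact (arcGraph_node hg.tail hg.head (H.atArc i)).symm ▸ by simpa [Arc.key, atArc] using H.hN

theorem legal_secondArc (hi : i < H.N) :
    (H.updateOp mode (H.secondArc mode i)).Legal mode
      (H.graph (H.others mode i) + arcGraph H.nodes (H.saArc i)) := by
  have hQ := notMem_others (H := H) (mode := mode) (i := i)
  cases mode with
  | incremental =>
    have hg := good_atArc hi
    refine ⟨rfl, fun h => hg.ne ?_, graph_add_atArc hi hQ, hg.pos⟩
    rw [← node_val hg.tail, ← node_val hg.head]
    exact congrArg _ h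
  | decremental =>
    have hg := good_saArc hi
    refine ⟨rfl, ?_⟩
    rw [Pi.add_apply, Pi.add_apply]
    refine Nat.add_pos_right _ ?_
    exact (arcGraph_node hg.tail hg.head (H.saArc i)).symm ▸ by simpa [Arc.key, saArc] using H.hN

theorem legalOps_phaseOps (hi : i ≤ H.N) :
    LegalOps mode (H.graph (H.linked mode i)) (H.phaseOps mode i) := by
  induction i with
  | zero => trivial
  | succ i ih =>
    refine ⟨legal_firstArc hi, trivial, ?_, ?_⟩
    · rw [apply_firstArc hi]
      exact legal_secondArc hi
    · rw [apply_firstArc hi]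
      refine (apply_secondArc (mode := mode) hi).symm ▸ ih (by omega)

theorem foldl_phaseOps (hi : i ≤ H.N) :
    (H.phaseOps mode i).foldl Op.apply (H.graph (H.linked mode i)) =
      H.graph (H.linked mode 0) := by
  induction i with
  | zero => rfl
  | succ i ih =>
    simp only [phaseOps, List.foldl_cons]
    rw [apply_firstArc hi]
    refine (congrArg (fun G => (H.phaseOps mode i).foldl Op.apply G)
      (apply_secondArc (mode := mode) hi)).trans (ih (by omega))

theorem length_phaseOps : (H.phaseOps mode i).length = 3 * i := by
  induction i with
  | zero => rfl
  | succ i ih => simp only [phaseOps, List.length_cons, ih]; omega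

theorem capacity_le_of_mem_phaseOps {o : Op H.nodes} (ho : o ∈ H.phaseOps mode i) :
    o.capacity ≤ H.N := by
  induction i with
  | zero => simp [phaseOps] at ho
  | succ i ih =>
    simp only [phaseOps, List.mem_cons] at ho
    rcases ho with rfl | rfl | rfl | ho
    · cases mode <;> simp [updateOp, Op.capacity, firstArc]
    · simp [Op.capacity]
    · cases mode <;> simp [updateOp, Op.capacity, secondArc]
    · exact ih ho

/-! ### The instance -/

variable (H)

/-- The starting edges. -/
def startArcs (mode : Mode) : List Arc :=
  match mode with
  | .incremental => []
  | .decremental => H.allArcs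

/-- The edges that are inserted before the phases. -/
def insertArcs (mode : Mode) : List Arc :=
  match mode with
  | .incremental => H.baseArcs
  | .decremental => []

/-- An instance with given starting edges and operations. -/
def mkInstance (L : List Arc) (ops : List (Op H.nodes)) : Instance where
  n := H.nodes
  s := H.s
  t := H.t
  edges := L.map H.edge
  ops := ops

/-- All operations. -/
def allOps (mode : Mode) : List (Op H.nodes) :=
  (H.insertArcs mode).map (H.updateOp .incremental) ++ H.phaseOps mode H.N

/-- The instance of dynamic flow. -/
def inst (mode : Mode) : Instance := H.mkInstance (H.startArcs mode) (H.allOps mode)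

variable {H}

theorem startGraph_mkInstance {L : List Arc} {ops : List (Op H.nodes)} (hL : ∀ e ∈ L, H.Good e)
    (hnd : (L.map Arc.key).Nodup) : (H.mkInstance L ops).startGraph = H.listGraph L := by
  have h := foldl_inserts (H := H) L (D := []) hL (by simpa using hnd)
  rw [List.nil_append] at h
  rw [← h, Instance.startGraph]
  simp only [mkInstance, List.foldl_map]
  rfl

theorem good_of_mem_startArcs {e : Arc} (he : e ∈ H.startArcs mode) : H.Good e := by
  cases mode with
  | incremental => simp [startArcs] at he
  | decremental => exact good_of_mem_allArcs he

theorem nodup_startArcs : ((H.startArcs mode).map Arc.key).Nodup := by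
  cases mode with
  | incremental => simp [startArcs]
  | decremental => exact nodup_allArcs

theorem startGraph_inst : (H.inst mode).startGraph = H.listGraph (H.startArcs mode) :=
  startGraph_mkInstance (fun _ => good_of_mem_startArcs) nodup_startArcs

theorem foldl_insertArcs :
    ((H.insertArcs mode).map (H.updateOp .incremental)).foldl Op.apply
      (H.listGraph (H.startArcs mode)) = H.graph (H.linked mode H.N) := by
  cases mode with
  | incremental =>
    rw [show H.linked .incremental H.N = ∅ from Ico_self _, ← listGraph_baseArcs]
    exact foldl_inserts (D := []) _ (fun _ => good_of_mem_baseArcs) nodup_baseArcs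
  | decremental => exact listGraph_allArcs

theorem finalGraph_inst : (H.inst mode).finalGraph = H.graph (H.linked mode 0) := by
  rw [Instance.finalGraph, startGraph_inst]
  refine (List.foldl_append).trans ?_
  exact (congrArg (fun G => (H.phaseOps mode H.N).foldl Op.apply G) foldl_insertArcs).trans
    (foldl_phaseOps le_rfl)

theorem legalOps_inst :
    LegalOps mode (H.listGraph (H.startArcs mode)) (H.allOps mode) := by
  have hp := legalOps_phaseOps (H := H) (mode := mode) le_rfl
  cases mode with
  | incremental =>
    refine legalOps_inserts (D := []) _ (fun _ => good_of_mem_baseArcs) nodup_baseArcs ?_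
    rw [show H.linked .incremental H.N = ∅ from Ico_self _, ← listGraph_baseArcs] at hp
    exact hp
  | decremental =>
    rw [show H.listGraph (H.startArcs .decremental) = H.graph (range H.N) from listGraph_allArcs]
    exact hp

theorem valid_inst : (H.inst mode).Valid mode := by
  refine ⟨?_, ?_, ?_, ?_, ?_⟩
  · exact fun h => absurd (congrArg Fin.val h) (by simp [inst, mkInstance, s, t])
  · have h := nodup_startArcs (H := H) (mode := mode)
    have h' := h.of_map
    simp only [inst, mkInstance, List.map_map]
    rw [List.nodup_map_iff_inj_on] at h ⊢
    · intro e he e' he' hee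
      simp only [Function.comp_apply, edge, Prod.mk.injEq] at hee
      have hg := good_of_mem_startArcs he
      have hg' := good_of_mem_startArcs he'
      refine h e he e' he' (Prod.ext ?_ ?_)
      · have := congrArg Fin.val hee.1
        rwa [node_val hg.tail, node_val hg'.tail] at this
      · have := congrArg Fin.val hee.2
        rwa [node_val hg.head, node_val hg'.head] at this
    · exact h'
    · exact h'
  · intro e he
    obtain ⟨a, ha, rfl⟩ := List.mem_map.1 he
    have hg := good_of_mem_startArcs ha
    refine ⟨fun h => hg.ne ?_, hg.pos⟩
    have := congrArg Fin.val h
    simp only [edge] at this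
    rwa [node_val hg.tail, node_val hg.head] at this
  · rintro rfl
    rfl
  · rw [startGraph_inst]
    exact legalOps_inst

theorem length_allArcs : H.allArcs.length = 2 * (H.N * H.M) + 3 * H.N := by
  simp only [allArcs, baseArcs, List.length_append, length_mainArcs, length_btArcs, length_stArcs]
  omega

theorem m_inst_le : (H.inst mode).m ≤ 2 * (H.N * H.M) + 3 * H.N := by
  rw [← length_allArcs]
  have hb : H.baseArcs.length ≤ H.allArcs.length := by simp [allArcs]
  refine max_le ?_ ?_
  · rw [startGraph_inst]
    refine (numEdges_listGraph_le _).trans ?_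
    cases mode <;> simp [startArcs]
  · rw [finalGraph_inst]
    cases mode with
    | incremental =>
      rw [show H.linked .incremental 0 = range H.N from
        (Nat.Ico_zero_eq_range H.N :),
        ← listGraph_allArcs]
      exact numEdges_listGraph_le _
    | decremental =>
      rw [show H.linked .decremental 0 = ∅ from rfl, ← listGraph_baseArcs]
      exact (numEdges_listGraph_le _).trans hb

/-- The isolated nodes exist for this bound: they make the number of nodes at least the number of
edges, so the graph is sparse already for `K = 1` and `p = 0`, and the logarithm only has to be at
least `1`. -/
theorem sparse_inst {K p : ℕ} (hK : 0 < K) : (H.inst mode).Sparse K p := by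
  have h1 : (H.inst mode).n = H.nodes := rfl
  rw [Instance.Sparse, h1]
  have h2 : 1 ≤ Nat.log 2 H.nodes := Nat.log_pos (by norm_num) (by simp [nodes])
  have h3 : 1 ≤ Nat.log 2 H.nodes ^ p := Nat.one_le_pow _ _ h2
  calc (H.inst mode).m ≤ 2 * (H.N * H.M) + 3 * H.N := m_inst_le
    _ ≤ H.nodes := by simp only [nodes]; nlinarith
    _ ≤ K * H.nodes := Nat.le_mul_of_pos_left _ hK
    _ ≤ K * H.nodes * Nat.log 2 H.nodes ^ p := Nat.le_mul_of_pos_right _ h3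

theorem length_edges_inst_le : (H.inst mode).edges.length ≤ 3 * (H.N * (H.M + 1)) := by
  have h : (H.inst mode).edges.length = (H.startArcs mode).length := List.length_map _
  rw [h]
  cases mode with
  | incremental => simp [startArcs]
  | decremental => rw [startArcs, length_allArcs]; nlinarith

theorem length_ops_inst_le : (H.inst mode).ops.length ≤ 4 * (H.N * (H.M + 1)) := by
  have h : (H.inst mode).ops.length = (H.insertArcs mode).length + 3 * H.N := by
    simp [inst, mkInstance, allOps, length_phaseOps]
  have hl : (H.insertArcs mode).length ≤ 2 * (H.N * H.M) + H.N := by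
    cases mode with
    | incremental => simp [insertArcs, baseArcs, length_mainArcs, length_btArcs]
    | decremental => simp [insertArcs]
  rw [h]
  nlinarith

theorem nodes_le : H.nodes ≤ 5 * (H.N * (H.M + 1)) := by
  have := H.hN
  simp only [nodes]
  nlinarith

/-- No capacity exceeds `N`, so the size is polynomial in `N (M + 1)`; only its logarithm matters,
for the word length. -/
theorem size_inst_le : (H.inst mode).size ≤ 24 * (H.N * (H.M + 1) * H.N) := by
  have h1 := length_edges_inst_le (H := H) (mode := mode)
  have h2 := length_ops_inst_le (H := H) (mode := mode)
  have h3 : (H.inst mode).n ≤ 5 * (H.N * (H.M + 1)) := nodes_le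
  have h4 : ((H.inst mode).edges.map fun e => e.2.2).sum ≤
      (H.inst mode).edges.length * H.N := by
    rw [← smul_eq_mul, ← List.length_map (f := fun e => e.2.2) (as := (H.inst mode).edges)]
    refine List.sum_le_card_nsmul _ _ fun c hc => ?_
    obtain ⟨e, he, rfl⟩ := List.mem_map.1 hc
    obtain ⟨a, ha, rfl⟩ := List.mem_map.1 he
    exact (good_of_mem_startArcs ha).le
  have h5 : ((H.inst mode).ops.map Op.capacity).sum ≤ (H.inst mode).ops.length * H.N := by
    rw [← smul_eq_mul, ← List.length_map (f := Op.capacity) (as := (H.inst mode).ops)]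
    refine List.sum_le_card_nsmul _ _ fun c hc => ?_
    obtain ⟨o, ho, rfl⟩ := List.mem_map.1 hc
    rcases List.mem_append.1 ho with ho | ho
    · obtain ⟨e, he, rfl⟩ := List.mem_map.1 ho
      cases mode with
      | incremental => exact (good_of_mem_baseArcs he).le
      | decremental => simp [insertArcs] at he
    · exact capacity_le_of_mem_phaseOps ho
  have hN := H.hN
  rw [Instance.size]
  generalize (H.inst mode).edges.length = a at *
  generalize (H.inst mode).ops.length = b at *
  have : H.N * (H.M + 1) ≤ H.N * (H.M + 1) * H.N := Nat.le_mul_of_pos_right _ hN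
  have := Nat.mul_le_mul_right H.N h1
  have := Nat.mul_le_mul_right H.N h2
  simp only [mul_assoc] at *
  omega

end Net

end DynFlow

/-! ### Splitting the assignments of a formula -/

namespace SAT

open WordRAM

/-- The literal with code `c` is true under the half assignment with the bits of `x`. The first
(second) half assignment concerns the variables smaller than `h` (from `h` on). -/
def HalfTrue (second : Bool) (h x c : ℕ) : Prop :=
  0 < c ∧ (if second then h < (c - 1) / 2 + 1 else (c - 1) / 2 < h) ∧
    (x >>> ((c - 1) / 2 - if second then h else 0)) % 2 = (c - 1) % 2

instance (second : Bool) (h x c : ℕ) : Decidable (HalfTrue second h x c) := by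
  unfold HalfTrue; infer_instance

/-- Whether one of the first `i` literals of the clause `j` is true under a half assignment. -/
def satBit (second : Bool) (inp : ℕ → ℕ) (h k x j : ℕ) : ℕ → ℕ
  | 0 => 0
  | i + 1 => satBit second inp h k x j i |||
      if HalfTrue second h x (inp (j * k + i)) then 1 else 0

theorem satBit_eq {second : Bool} {inp : ℕ → ℕ} {h k x j : ℕ} (i : ℕ) :
    satBit second inp h k x j i ≤ 1 ∧ (satBit second inp h k x j i = 1 ↔
      ∃ i' < i, HalfTrue second h x (inp (j * k + i'))) := by
  induction i with
  | zero => simp [satBit]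
  | succ i ih =>
    simp only [satBit, Nat.exists_lt_succ_right, ← ih.2]
    rcases Nat.le_one_iff_eq_zero_or_eq_one.1 ih.1 with h0 | h0 <;> rw [h0] <;>
      split_ifs with h1 <;> simp [h1]

variable {n k : ℕ} {φ : CNF n}

theorem input_mem (hk : 0 < k) (φ : CNF n) {j i : ℕ} (hi : i < k) :
    (inputState k φ).mem 0 (j * k + i) = ((φ.getD j []).map Literal.code).getD i 0 := by
  have h1 : (j * k + i) / k = j := by
    rw [add_comm, Nat.add_mul_div_right _ _ hk, Nat.div_eq_of_lt hi, zero_add]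
  have h2 : (j * k + i) % k = i := by
    rw [add_comm, Nat.add_mul_mod_self_right, Nat.mod_eq_of_lt hi]
  simp only [inputState, if_true, h1, h2]

theorem input_mem_le (k : ℕ) (φ : CNF n) (y : ℕ) : (inputState k φ).mem 0 y ≤ 2 * n := by
  simp only [inputState, if_true, List.getD_eq_getElem?_getD, List.getElem?_map]
  rcases (φ[y / k]?.getD [])[y % k]? with _ | l
  · simp
  · have := l.1.isLt
    simp only [Option.map_some, Option.getD_some, Literal.code]
    split_ifs <;> omega

/-- Clauses with fewer than `k` literals are padded with the code `0`, which `HalfTrue` rejects, and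
`IsKCNF` ensures that the `k` cells contain the whole clause. -/
theorem satBit_iff (hk : 0 < k) (hφ : IsKCNF k φ) {second : Bool} {h x j : ℕ}
    (hj : j < φ.length) :
    satBit second ((inputState k φ).mem 0) h k x j k = 1 ↔
      ∃ l ∈ φ[j], (if second then h ≤ l.1.val else l.1.val < h) ∧
        x.testBit (l.1.val - if second then h else 0) = l.2 := by
  have hcode : ∀ l : Literal n, HalfTrue second h x l.code ↔
      (if second then h ≤ l.1.val else l.1.val < h) ∧
        x.testBit (l.1.val - if second then h else 0) = l.2 := by
    rintro ⟨v, b⟩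
    have h1 : (Literal.code (v, b) - 1) / 2 = v := by
      simp only [Literal.code]; split_ifs <;> omega
    have h2 : (Literal.code (v, b) - 1) % 2 = if b then 1 else 0 := by
      simp only [Literal.code]; split_ifs <;> omega
    have h3 : 0 < Literal.code (v, b) := by simp [Literal.code]
    simp only [HalfTrue, h1, h2, h3, true_and, Nat.lt_succ_iff, Nat.testBit_eq_decide_div_mod_eq,
      Nat.shiftRight_eq_div_pow]
    refine and_congr Iff.rfl ?_
    have := Nat.mod_two_eq_zero_or_one (x / 2 ^ (v.val - if second then h else 0))
    cases b <;> simp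
  have hlen : (φ[j]).length ≤ k := hφ _ (List.getElem_mem hj)
  rw [(satBit_eq k).2]
  constructor
  · rintro ⟨i, hi, hi'⟩
    rw [input_mem hk φ hi, List.getD_eq_getElem _ _ hj] at hi'
    have hil : i < (φ[j]).length := by
      by_contra hcon
      rw [List.getD_eq_default _ _ (by simpa using hcon)] at hi'
      exact absurd hi'.1 (lt_irrefl _)
    rw [List.getD_eq_getElem _ _ (by simpa using hil), List.getElem_map, hcode] at hi'
    exact ⟨_, List.getElem_mem hil, hi'⟩
  · rintro ⟨l, hl, hl'⟩
    obtain ⟨i, hi, rfl⟩ := List.getElem_of_mem hl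
    refine ⟨i, hi.trans_le hlen, ?_⟩
    rw [input_mem hk φ (hi.trans_le hlen), List.getD_eq_getElem _ _ hj,
      List.getD_eq_getElem _ _ (by simpa using hi), List.getElem_map, hcode]
    exact hl'

/-- A formula is satisfiable if and only if two half assignments together satisfy all clauses. -/
theorem satisfiable_iff (hk : 0 < k) (hφ : IsKCNF k φ) {h : ℕ} (hn : n ≤ 2 * h) :
    Satisfiable φ ↔ ∃ x < 2 ^ h, ∃ y < 2 ^ h, ∀ j < φ.length,
      satBit false ((inputState k φ).mem 0) h k x j k = 1 ∨
      satBit true ((inputState k φ).mem 0) h k y j k = 1 := by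
  constructor
  · rintro ⟨a, ha⟩
    -- Two blocks of `h` variables may exceed `n`; the assignment is `false` on the surplus.
    let f : ℕ → Bool := fun v => if hv : v < n then a ⟨v, hv⟩ else false
    have hf : ∀ v : Fin n, f v = a v := fun v => by simp [f]
    refine ⟨Nat.ofBits fun i : Fin h => f i, Nat.ofBits_lt_two_pow _,
      Nat.ofBits fun i : Fin h => f (h + i), Nat.ofBits_lt_two_pow _, fun j hj => ?_⟩
    rw [satBit_iff hk hφ hj, satBit_iff hk hφ hj]
    obtain ⟨l, hl, hal⟩ := ha _ (List.getElem_mem hj)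
    have := l.1.isLt
    by_cases hlh : l.1.val < h
    · refine Or.inl ⟨l, hl, by simpa using hlh, ?_⟩
      simp only [Bool.false_eq_true, if_false, Nat.sub_zero]
      rw [Nat.testBit_ofBits_lt _ _ hlh, ← hal]
      exact hf _
    · refine Or.inr ⟨l, hl, by simpa using hlh, ?_⟩
      simp only [if_true]
      rw [Nat.testBit_ofBits_lt _ _ (by omega), ← hal, ← hf]
      congr 1
      simp only
      omega
  · rintro ⟨x, -, y, -, hxy⟩
    refine ⟨fun v => if v.val < h then x.testBit v else y.testBit (v - h), fun c hc => ?_⟩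
    obtain ⟨j, hj, rfl⟩ := List.getElem_of_mem hc
    have := hxy j hj
    rw [satBit_iff hk hφ hj, satBit_iff hk hφ hj] at this
    rcases this with ⟨l, hl, h1, h2⟩ | ⟨l, hl, h1, h2⟩
    · refine ⟨l, hl, ?_⟩
      simp only [Bool.false_eq_true, if_false, Nat.sub_zero] at h1 h2
      simp only [if_pos h1, h2]
    · refine ⟨l, hl, ?_⟩
      simp only [if_true] at h1 h2
      simp only [if_neg h1.not_gt, h2]

/-- The network of a formula. -/
def net (k h : ℕ) (φ : CNF n) : DynFlow.Net where
  N := 2 ^ h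
  M := φ.length
  α x j := satBit false ((inputState k φ).mem 0) h k x j k
  β x j := satBit true ((inputState k φ).mem 0) h k x j k
  hN := by positivity
  hα _ _ := (satBit_eq k).1
  hβ _ _ := (satBit_eq k).1

end SAT

namespace WordRAM

/-! ### Expressions for the arcs

The host has the number of clauses in variable `1`, the number of half assignments in variable `2`,
the number of variables of a half assignment in variable `3` and a counter in variable `4`. -/

namespace Expr

/-- Whether a literal with the code `c` is true under a half assignment `x`. -/
def halfTrue (second : Bool) (x c : Expr) : Expr :=
  bin .and (bin .lt (num 0) c) (bin .and
    (if second then bin .lt (var 3) (bin .add (bin .div (bin .sub c (num 1)) (num 2)) (num 1))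
      else bin .lt (bin .div (bin .sub c (num 1)) (num 2)) (var 3))
    (bin .eq (bin .mod (bin .shr x (bin .sub (bin .div (bin .sub c (num 1)) (num 2))
      (if second then var 3 else num 0))) (num 2)) (bin .mod (bin .sub c (num 1)) (num 2))))

/-- Whether one of the first `i` literals of the clause `j` is true under a half assignment. -/
def satBit (second : Bool) (k : ℕ) (x j : Expr) : ℕ → Expr
  | 0 => num 0
  | i + 1 => bin .or (satBit second k x j i)
      (halfTrue second x (load (bin .add (bin .mul j (num k)) (num i))))

theorem eval_halfTrue (inp v : ℕ → ℕ) (second : Bool) (x c : Expr) :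
    (halfTrue second x c).eval inp v =
      if SAT.HalfTrue second (v 3) (x.eval inp v) (c.eval inp v) then 1 else 0 := by
  have hand : ∀ (p q : Prop) [Decidable p] [Decidable q],
      BinOp.and.eval (if p then 1 else 0) (if q then 1 else 0) = if p ∧ q then 1 else 0 := by
    intro p q _ _
    by_cases hp : p <;> by_cases hq : q <;> simp [hp, hq, BinOp.eval]
  have hlt : ∀ a b, BinOp.lt.eval a b = if a < b then 1 else 0 := fun _ _ => rfl
  have heq : ∀ a b, BinOp.eq.eval a b = if a = b then 1 else 0 := fun _ _ => rfl
  cases second <;>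
    simp only [halfTrue, eval, hand, hlt, heq, SAT.HalfTrue, if_true, Bool.false_eq_true,
      if_false] <;> rfl

/-- Since `k` is a constant of the program, the search through a clause unrolls into one expression
whose cost and size depend on `k` alone. -/
theorem eval_satBit (inp v : ℕ → ℕ) (second : Bool) (k : ℕ) (x j : Expr) (i : ℕ) :
    (satBit second k x j i).eval inp v =
      SAT.satBit second inp (v 3) k (x.eval inp v) (j.eval inp v) i := by
  induction i with
  | zero => rfl
  | succ i ih =>
    simp only [satBit, SAT.satBit, eval, ih, eval_halfTrue, BinOp.eval]
    rfl

theorem noShl_satBit {second : Bool} {k : ℕ} {x j : Expr} (hx : x.NoShl) (hj : j.NoShl) (i : ℕ) :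
    (satBit second k x j i).NoShl := by
  induction i with
  | zero => trivial
  | succ i ih => cases second <;> simp [satBit, halfTrue, NoShl, ih, hx, hj]

/-- The half assignment of the counter. -/
def elt : Expr := bin .div (var 4) (var 1)

/-- The clause of the counter. -/
def clause : Expr := bin .mod (var 4) (var 1)

/-- The first node of the clause of the counter. -/
def clauseNode : Expr :=
  bin .add (bin .add (num 2) (bin .mul (num 2) (var 2))) (bin .mul (num 3) clause)

end Expr

/-- Expressions for tail, head and capacity of an arc. -/
structure ArcExpr where
  tail : Expr
  head : Expr
  cap : Expr

namespace ArcExpr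

/-- The value of the expressions. -/
def eval (inp v : ℕ → ℕ) (a : ArcExpr) : DynFlow.Arc :=
  (a.tail.eval inp v, a.head.eval inp v, a.cap.eval inp v)

/-- All values in the evaluation fit into words. -/
def Fits (w : ℕ) (inp v : ℕ → ℕ) (a : ArcExpr) : Prop :=
  a.tail.Fits w inp v ∧ a.head.Fits w inp v ∧ a.cap.Fits w inp v

/-- The number of steps of the evaluation. -/
def cost (a : ArcExpr) : ℕ := a.tail.cost + a.head.cost + a.cap.cost

/-- A number of blocks of bits that suffices for the evaluation. -/
def size (a : ArcExpr) : ℕ := a.tail.size + a.head.size + a.cap.size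

/-- There are no left shifts. -/
def NoShl (a : ArcExpr) : Prop := a.tail.NoShl ∧ a.head.NoShl ∧ a.cap.NoShl

theorem fits_of_size {inp v : ℕ → ℕ} {w W : ℕ} (hW : 1 ≤ W) (hv : ∀ r, v r < 2 ^ W)
    (hi : ∀ x, inp x < 2 ^ W) {a : ArcExpr} (ha : a.NoShl) (hw : a.size * W ≤ w) :
    a.Fits w inp v := by
  rw [size, add_mul, add_mul] at hw
  exact ⟨Expr.fits_of_size hW hv hi _ ha.1 (by omega),
    Expr.fits_of_size hW hv hi _ ha.2.1 (by omega),
    Expr.fits_of_size hW hv hi _ ha.2.2 (by omega)⟩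

open WordRAM.Expr

/-- The arc from a half assignment to a clause. -/
def ac (k : ℕ) : ArcExpr where
  tail := bin .add (num 2) elt
  head := bin .add clauseNode (satBit false k elt clause k)
  cap := var 2

/-- The arc from a clause to a half assignment. -/
def cb (k : ℕ) : ArcExpr where
  tail := bin .add clauseNode (bin .mul (num 2) (satBit true k elt clause k))
  head := bin .add (bin .add (num 2) (var 2)) elt
  cap := num 1

/-- The arc from a half assignment to the sink. -/
def bt : ArcExpr where
  tail := bin .add (bin .add (num 2) (var 2)) (var 4)
  head := num 1
  cap := num 1

/-- The arc from the source to a half assignment, with a given capacity. -/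
def sa (c : Expr) : ArcExpr where
  tail := num 0
  head := bin .add (num 2) (var 4)
  cap := c

/-- The arc from a half assignment to the sink, with a given capacity. -/
def at' (c : Expr) : ArcExpr where
  tail := bin .add (num 2) (var 4)
  head := num 1
  cap := c

theorem noShl_ac (k : ℕ) : (ac k).NoShl := by
  have h := noShl_satBit (second := false) (k := k) (x := elt) (j := clause)
    (by simp [elt, Expr.NoShl]) (by simp [clause, Expr.NoShl]) k
  simp [NoShl, ac, Expr.NoShl, clauseNode, elt, clause] at h ⊢
  exact h

theorem noShl_cb (k : ℕ) : (cb k).NoShl := by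
  have h := noShl_satBit (second := true) (k := k) (x := elt) (j := clause)
    (by simp [elt, Expr.NoShl]) (by simp [clause, Expr.NoShl]) k
  simp [NoShl, cb, Expr.NoShl, clauseNode, elt, clause] at h ⊢
  exact h

end ArcExpr

section Eval

open SAT ArcExpr

variable {n k h : ℕ} {φ : CNF n} {v : ℕ → ℕ} {i : ℕ}

/-- The variables of the host have the values for the network of a formula. -/
structure Env (h : ℕ) (φ : CNF n) (v : ℕ → ℕ) : Prop where
  clauses : v 1 = φ.length
  elts : v 2 = 2 ^ h
  half : v 3 = h

theorem Env.update {r : ℕ} (hv : Env h φ v) (hr : 4 ≤ r) (x : ℕ) :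
    Env h φ (Function.update v r x) where
  clauses := by rw [Function.update_of_ne (by omega), hv.clauses]
  elts := by rw [Function.update_of_ne (by omega), hv.elts]
  half := by rw [Function.update_of_ne (by omega), hv.half]

theorem eval_ac (hv : Env h φ v) :
    (ac k).eval ((inputState k φ).mem 0) v = (net k h φ).acArc (v 4) := by
  simp only [ArcExpr.eval, ac, Expr.eval, BinOp.eval, Expr.eval_satBit, Expr.elt, Expr.clause,
    Expr.clauseNode, hv.clauses, hv.elts, hv.half]
  rfl

theorem eval_cb (hv : Env h φ v) :
    (cb k).eval ((inputState k φ).mem 0) v = (net k h φ).cbArc (v 4) := by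
  simp only [ArcExpr.eval, cb, Expr.eval, BinOp.eval, Expr.eval_satBit, Expr.elt, Expr.clause,
    Expr.clauseNode, hv.clauses, hv.elts, hv.half]
  rfl

theorem eval_bt (hv : Env h φ v) :
    bt.eval ((inputState k φ).mem 0) v = (net k h φ).btArc (v 4) := by
  simp only [ArcExpr.eval, bt, Expr.eval, BinOp.eval, hv.elts]
  rfl

theorem eval_sa (hv : Env h φ v) :
    (sa (.var 2)).eval ((inputState k φ).mem 0) v = (net k h φ).saArc (v 4) := by
  simp only [ArcExpr.eval, sa, Expr.eval, BinOp.eval, hv.elts]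
  rfl

theorem eval_at (hv : Env h φ v) :
    (at' (.var 2)).eval ((inputState k φ).mem 0) v = (net k h φ).atArc (v 4) := by
  simp only [ArcExpr.eval, at', Expr.eval, BinOp.eval, hv.elts]
  rfl

end Eval

end WordRAM

/-! ### The host program that feeds arcs to the flow algorithm. -/

namespace WordRAM

open DynFlow

variable {inp v : ℕ → ℕ} {τ : State} {w : ℕ}

/-! ### Producing arcs -/

/-- `em` handles the first arc of a list, and may take time from a supply for that. -/
def Emits (w : ℕ) (inp : ℕ → ℕ) (em : ArcExpr → Prog) (Inv : List Arc → State → ℕ → Prop) : Prop :=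
  ∀ (a : ArcExpr) (v : ℕ → ℕ) (τ : State) (l : List Arc) (t : ℕ), a.Fits w inp v →
    Inv (a.eval inp v :: l) τ t → ∃ τ' t₁ t₂, t₁ + t₂ = t ∧
      Runs w inp (em a) v τ v τ' (a.cost + 5 + t₁) ∧ Inv l τ' t₂

/-- Handle a list of arcs. -/
def emitAll (em : ArcExpr → Prog) : List ArcExpr → Prog
  | [] => .skip
  | a :: l => .seq (em a) (emitAll em l)

/-- The number of steps for a list of arcs. -/
def emitCost : List ArcExpr → ℕ
  | [] => 1
  | a :: l => a.cost + 5 + emitCost l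

/-- Count the variable `4` down to zero. -/
def countLoop (body : Prog) : Prog :=
  .loop (3 * 4) (.seq (assign 4 (.bin .sub (.var 4) (.num 1))) body)

theorem runs_decrement (hw : 1 ≤ w) {i : ℕ} (hi : i + 1 < 2 ^ w) :
    Runs w inp (assign 4 (.bin .sub (.var 4) (.num 1))) (Function.update v 4 (i + 1)) τ
      (Function.update v 4 i) τ 4 := by
  have h2 : 1 < 2 ^ w := Nat.one_lt_two_pow (by omega)
  have h := runs_assign (w := w) (inp := inp) (v := Function.update v 4 (i + 1)) (τ := τ)
    (e := .bin .sub (.var 4) (.num 1)) 4 (by simp [Expr.Fits, Expr.eval, BinOp.eval]; omega)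
  simpa [Expr.eval, BinOp.eval, Expr.cost] using h

/-- The supply `t` is the time that the flow algorithm spends on everything still to come. It is
only split and never estimated for a single update, as the bound to be used is amortized. -/
theorem Emits.all {em : ArcExpr → Prog} {Inv : List Arc → State → ℕ → Prop}
    (hem : Emits w inp em Inv) {l : List Arc} (bs : List ArcExpr) : ∀ {τ : State} {t : ℕ},
    (∀ b ∈ bs, b.Fits w inp v) → Inv (bs.map (ArcExpr.eval inp v) ++ l) τ t →
    ∃ τ' t₁ t₂, t₁ + t₂ = t ∧
      Runs w inp (emitAll em bs) v τ v τ' (emitCost bs + t₁) ∧ Inv l τ' t₂ := by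
  induction bs with
  | nil =>
    intro τ t _ h
    exact ⟨τ, 0, t, zero_add t, fun σ hσ => ⟨σ, 1, .skip σ, le_rfl, hσ⟩, h⟩
  | cons a bs ih =>
    intro τ t hfit h
    obtain ⟨τ₁, t₁, t₂, ht, hr, hI⟩ := hem a v τ _ t (hfit a List.mem_cons_self) h
    obtain ⟨τ₂, t₃, t₄, ht', hr', hI'⟩ := ih (fun b hb => hfit b (List.mem_cons_of_mem _ hb)) hI
    refine ⟨τ₂, t₁ + t₃, t₄, by omega, (hr.seq hr').mono ?_, hI'⟩
    simp only [emitCost]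
    omega

/-- The counter is decreased before the body runs, so the body sees `i` when `arcs (i + 1)` is left.
The lists of arcs and of phases are therefore defined by descending recursion. -/
theorem Emits.loop {em : ArcExpr → Prog} {Inv : List Arc → State → ℕ → Prop}
    (hem : Emits w inp em Inv) (hw : 1 ≤ w) {l : List Arc} {bs : List ArcExpr}
    {arcs : ℕ → List Arc} (h0 : arcs 0 = []) {k : ℕ} (hk : k < 2 ^ w)
    (hfit : ∀ i < k, ∀ b ∈ bs, b.Fits w inp (Function.update v 4 i))
    (hsucc : ∀ i < k,
      arcs (i + 1) = bs.map (ArcExpr.eval inp (Function.update v 4 i)) ++ arcs i) :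
    ∀ {τ : State} {t : ℕ}, Inv (arcs k ++ l) τ t → ∃ τ' t₁ t₂, t₁ + t₂ = t ∧
      Runs w inp (countLoop (emitAll em bs)) (Function.update v 4 k) τ (Function.update v 4 0) τ'
        (k * (emitCost bs + 5) + 1 + t₁) ∧ Inv l τ' t₂ := by
  induction k with
  | zero =>
    intro τ t h
    rw [h0, List.nil_append] at h
    exact ⟨τ, 0, t, zero_add t, (Runs.loop_done (by simp)).mono (by simp), h⟩
  | succ k ih =>
    intro τ t h
    rw [hsucc k (by omega), List.append_assoc] at h
    obtain ⟨τ₁, t₁, t₂, ht, hr, hI⟩ := hem.all bs (hfit k (by omega)) h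
    obtain ⟨τ₂, t₃, t₄, ht', hr', hI'⟩ := ih (by omega) (fun i hi => hfit i (by omega))
      (fun i hi => hsucc i (by omega)) hI
    refine ⟨τ₂, t₁ + t₃, t₄, by omega, ?_, hI'⟩
    refine (Runs.loop_step (by simp) ((runs_decrement hw hk).seq hr) hr').mono ?_
    rw [add_mul, one_mul]
    omega

/-! ### Bounds for the words -/

/-- The sum of the costs of all expressions and instructions in the bodies of the loops. -/
def stepCost (k : ℕ) : ℕ :=
  emitCost [.ac k, .cb k] + emitCost [.bt] + emitCost [.sa (.var 2), .at' (.var 2)] + 60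

/-- A number of blocks of bits that suffices for all expressions. -/
def wordCost (k : ℕ) : ℕ := (ArcExpr.ac k).size + (ArcExpr.cb k).size + 30

/-- Words have sufficiently many bits for expressions whose variables have at most `W` bits. -/
structure Wide (k W w : ℕ) (inp : ℕ → ℕ) : Prop where
  pos : 1 ≤ W
  le : wordCost k * W ≤ w
  inp : ∀ x, inp x < 2 ^ W

variable {k W : ℕ}

theorem Wide.le_w (h : Wide k W w inp) {e : ℕ} (he : e ≤ wordCost k) : e * W ≤ w :=
  (Nat.mul_le_mul_right W he).trans h.le

theorem Wide.W_le_w (h : Wide k W w inp) : W ≤ w := by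
  simpa using h.le_w (e := 1) (by simp [wordCost])

theorem Wide.one_le (h : Wide k W w inp) : 1 ≤ w := h.pos.trans h.W_le_w

theorem Wide.lt (h : Wide k W w inp) {x : ℕ} (hx : x < 2 ^ W) : x < 2 ^ w :=
  hx.trans_le (Nat.pow_le_pow_right (by norm_num) h.W_le_w)

theorem Wide.fits (h : Wide k W w inp) (hv : ∀ r, v r < 2 ^ W) {e : Expr} (he : e.NoShl)
    (hs : e.size ≤ wordCost k) : e.Fits w inp v :=
  Expr.fits_of_size h.pos hv h.inp e he (h.le_w hs)

theorem Wide.fitsArc (h : Wide k W w inp) (hv : ∀ r, v r < 2 ^ W) {a : ArcExpr} (ha : a.NoShl)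
    (hs : a.size ≤ wordCost k) : a.Fits w inp v :=
  ArcExpr.fits_of_size h.pos hv h.inp ha (h.le_w hs)

theorem update_lt {B r x : ℕ} (hv : ∀ r, v r < B) (hx : x < B) (s : ℕ) :
    Function.update v r x s < B := by
  by_cases hs : s = r
  · subst hs; simpa using hx
  · simpa [hs] using hv s

/-! ### Producing the lists of arcs -/

/-- Produce the unchanging arcs. -/
def baseProg (em : ArcExpr → Prog) (k : ℕ) : Prog :=
  .seq (assign 4 (.bin .mul (.var 2) (.var 1)))
    (.seq (countLoop (emitAll em [.ac k, .cb k]))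
      (.seq (assign 4 (.var 2)) (countLoop (emitAll em [.bt]))))

/-- Produce all arcs. -/
def allProg (em : ArcExpr → Prog) (k : ℕ) : Prog :=
  .seq (baseProg em k) (.seq (assign 4 (.var 2))
    (countLoop (emitAll em [.sa (.var 2), .at' (.var 2)])))

section Lists

open SAT

variable {n h : ℕ} {φ : CNF n}

theorem Emits.base {em : ArcExpr → Prog} {Inv : List Arc → State → ℕ → Prop}
    (hem : Emits w ((inputState k φ).mem 0) em Inv)
    (hW : Wide k W w ((inputState k φ).mem 0)) (hv : ∀ r, v r < 2 ^ W) (hE : Env h φ v)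
    (hNM : 2 ^ h * φ.length < 2 ^ W) {l : List Arc} {t : ℕ}
    (hI : Inv ((net k h φ).baseArcs ++ l) τ t) :
    ∃ τ' t₁ t₂, t₁ + t₂ = t ∧ Runs w ((inputState k φ).mem 0) (baseProg em k) v τ
      (Function.update v 4 0) τ' ((2 ^ h * φ.length + 2 ^ h + 1) * stepCost k + t₁) ∧
      Inv l τ' t₂ := by
  have hN : 2 ^ h < 2 ^ W := hE.elts ▸ hv 2
  have r₁ := runs_assign (τ := τ) (e := .bin .mul (.var 2) (.var 1)) 4
    (hW.fits hv (by simp [Expr.NoShl]) (by simp [Expr.size, wordCost]))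
  rw [show Expr.eval ((inputState k φ).mem 0) v (.bin .mul (.var 2) (.var 1)) =
    2 ^ h * φ.length by simp [Expr.eval, BinOp.eval, hE.elts, hE.clauses]] at r₁
  rw [Net.baseArcs, List.append_assoc] at hI
  obtain ⟨τ₂, t₁, t₂, ht, r₂, hI⟩ := hem.loop (v := v) (bs := [.ac k, .cb k]) hW.one_le
    (arcs := (net k h φ).mainArcs) rfl (k := 2 ^ h * φ.length) (hW.lt hNM)
    (by
      intro i hi b hb
      have hv' := update_lt (r := 4) hv (hi.trans hNM)
      simp only [List.mem_cons, List.not_mem_nil, or_false] at hb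
      rcases hb with rfl | rfl
      · exact hW.fitsArc hv' (ArcExpr.noShl_ac k) (by simp only [wordCost]; omega)
      · exact hW.fitsArc hv' (ArcExpr.noShl_cb k) (by simp only [wordCost]; omega))
    (by
      intro i hi
      have hE' := hE.update (r := 4) le_rfl i
      simp only [List.map_cons, List.map_nil, eval_ac hE', eval_cb hE', Function.update_self]
      rfl) hI
  have r₃ := runs_assign (τ := τ₂) (e := .var 2) 4
    (hW.fits (update_lt (r := 4) hv (x := 0) (by positivity)) (by simp [Expr.NoShl])
      (by simp [Expr.size, wordCost]))
  rw [show Expr.eval ((inputState k φ).mem 0) (Function.update v 4 0) (.var 2) = 2 ^ h by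
    simp [Expr.eval, hE.elts], Function.update_idem] at r₃
  obtain ⟨τ₄, t₃, t₄, ht', r₄, hI⟩ := hem.loop (v := v) (bs := [.bt]) hW.one_le
    (arcs := (net k h φ).btArcs) rfl (k := 2 ^ h) (hW.lt hN)
    (by
      intro i hi b hb
      have hv' := update_lt (r := 4) hv (hi.trans hN)
      simp only [List.mem_cons, List.not_mem_nil, or_false] at hb
      subst hb
      exact hW.fitsArc hv' (by simp [ArcExpr.NoShl, ArcExpr.bt, Expr.NoShl])
        (by simp [ArcExpr.size, ArcExpr.bt, Expr.size, wordCost]))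
    (by
      intro i hi
      have hE' := hE.update (r := 4) le_rfl i
      simp only [List.map_cons, List.map_nil, eval_bt hE', Function.update_self]
      rfl) hI
  refine ⟨τ₄, t₁ + t₃, t₄, by omega, (r₁.seq (r₂.seq (r₃.seq r₄))).mono ?_, hI⟩
  have e1 : emitCost [.ac k, .cb k] + 5 ≤ stepCost k := by simp only [stepCost]; omega
  have e2 : emitCost [.bt] + 5 ≤ stepCost k := by simp only [stepCost]; omega
  have e3 : 60 ≤ stepCost k := by simp only [stepCost]; omega
  have := Nat.mul_le_mul_left (2 ^ h * φ.length) e1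
  have := Nat.mul_le_mul_left (2 ^ h) e2
  simp only [Expr.cost, add_mul, one_mul] at *
  omega

theorem Emits.allArcs {em : ArcExpr → Prog} {Inv : List Arc → State → ℕ → Prop}
    (hem : Emits w ((inputState k φ).mem 0) em Inv)
    (hW : Wide k W w ((inputState k φ).mem 0)) (hv : ∀ r, v r < 2 ^ W) (hE : Env h φ v)
    (hNM : 2 ^ h * φ.length < 2 ^ W) {t : ℕ} (hI : Inv (net k h φ).allArcs τ t) :
    ∃ τ' t₁ t₂, t₁ + t₂ = t ∧ Runs w ((inputState k φ).mem 0) (allProg em k) v τ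
      (Function.update v 4 0) τ' ((2 ^ h * φ.length + 2 * 2 ^ h + 2) * stepCost k + t₁) ∧
      Inv [] τ' t₂ := by
  have hN : 2 ^ h < 2 ^ W := hE.elts ▸ hv 2
  obtain ⟨τ₂, t₁, t₂, ht, r₂, hI⟩ := hem.base hW hv hE hNM hI
  have r₃ := runs_assign (τ := τ₂) (e := .var 2) 4
    (hW.fits (update_lt (r := 4) hv (x := 0) (by positivity)) (by simp [Expr.NoShl])
      (by simp [Expr.size, wordCost]))
  rw [show Expr.eval ((inputState k φ).mem 0) (Function.update v 4 0) (.var 2) = 2 ^ h by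
    simp [Expr.eval, hE.elts], Function.update_idem] at r₃
  obtain ⟨τ₄, t₃, t₄, ht', r₄, hI⟩ := hem.loop (v := v) (l := [])
    (bs := [.sa (.var 2), .at' (.var 2)]) hW.one_le
    (arcs := (net k h φ).stArcs) rfl (k := 2 ^ h) (hW.lt hN)
    (by
      intro i hi b hb
      have hv' := update_lt (r := 4) hv (hi.trans hN)
      simp only [List.mem_cons, List.not_mem_nil, or_false] at hb
      rcases hb with rfl | rfl
      · exact hW.fitsArc hv' (by simp [ArcExpr.NoShl, ArcExpr.sa, Expr.NoShl])
          (by simp [ArcExpr.size, ArcExpr.sa, Expr.size, wordCost])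
      · exact hW.fitsArc hv' (by simp [ArcExpr.NoShl, ArcExpr.at', Expr.NoShl])
          (by simp [ArcExpr.size, ArcExpr.at', Expr.size, wordCost]))
    (by
      intro i hi
      have hE' := hE.update (r := 4) le_rfl i
      simp only [List.map_cons, List.map_nil, eval_sa hE' (k := k), eval_at hE' (k := k),
        Function.update_self]
      rfl) (by rw [List.append_nil]; exact hI)
  refine ⟨τ₄, t₁ + t₃, t₄, by omega, (r₂.seq (r₃.seq r₄)).mono ?_, hI⟩
  have e2 : emitCost [.sa (.var 2), .at' (.var 2)] + 5 ≤ stepCost k := by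
    simp only [stepCost]; omega
  have e3 : 60 ≤ stepCost k := by simp only [stepCost]; omega
  have := Nat.mul_le_mul_left (2 ^ h) e2
  simp only [Expr.cost, add_mul, one_mul, mul_assoc] at *
  omega

end Lists

/-! ### Arcs as updates -/

/-- Perform an update of the dynamic algorithm. -/
def emitUpdate (A : Algorithm) (a : ArcExpr) : Prog :=
  .seq (setGuest 0 a.tail) (.seq (setGuest 1 a.head) (.seq (setGuest 2 a.cap) A.update.embed))

theorem runs_emitUpdate {A : Algorithm} {a : ArcExpr} {τ' : State} {T : ℕ}
    (ha : a.Fits w inp v)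
    (h : Exec w A.update
      (passArgs τ (a.eval inp v).1 (a.eval inp v).2.1 (a.eval inp v).2.2) τ' T) :
    Runs w inp (emitUpdate A a) v τ v τ' (a.cost + 3 + T) := by
  refine ((runs_setGuest 0 ha.1).seq ((runs_setGuest 1 ha.2.1).seq
    ((runs_setGuest 2 ha.2.2).seq (Runs.embed h)))).mono ?_
  simp only [ArcExpr.cost]
  omega

/-- A deletion receives `0` as its third argument. Giving the arc to be deleted capacity `0` lets
one program issue the updates of both modes. -/
theorem serves_update {A : Algorithm} {H : Net} {mode : Mode} {e : Arc} {s t : Fin H.nodes}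
    {G : CapGraph H.nodes} {ops : List (Op H.nodes)} {T : ℕ} (h1 : e.1 < H.nodes)
    (h2 : e.2.1 < H.nodes) (h0 : mode = .decremental → e.2.2 = 0)
    (h : A.Serves w s t G τ (H.updateOp mode e :: ops) T) :
    ∃ τ' T₁ T₂, T₁ + T₂ = T ∧ Exec w A.update (passArgs τ e.1 e.2.1 e.2.2) τ' T₁ ∧
      A.Serves w s t ((H.updateOp mode e).apply G) τ' ops T₂ := by
  cases mode with
  | incremental =>
    cases h with
    | insert u v c hrun hrest =>
      rw [Net.node_val h1, Net.node_val h2] at hrun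
      exact ⟨_, _, _, rfl, hrun, hrest⟩
  | decremental =>
    cases h with
    | delete u v hrun hrest =>
      rw [Net.node_val h1, Net.node_val h2] at hrun
      exact ⟨_, _, _, rfl, (h0 rfl).symm ▸ hrun, hrest⟩

/-- The dynamic algorithm serves the insertion of the arcs of the list followed by `ops`, and
after the insertions the graph is `G'`. -/
def InsertInv (A : Algorithm) (w : ℕ) (H : Net) (G' : CapGraph H.nodes) (ops : List (Op H.nodes))
    (l : List Arc) (τ : State) (t : ℕ) : Prop :=
  (∀ e ∈ l, H.Good e) ∧ ∃ G,
    A.Serves w H.s H.t G τ (l.map (H.updateOp .incremental) ++ ops) t ∧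
      (l.map (H.updateOp .incremental)).foldl Op.apply G = G'

theorem emits_emitUpdate {A : Algorithm} {w' : ℕ} (hw : w' ≤ w) {H : Net} {G' : CapGraph H.nodes}
    {ops : List (Op H.nodes)} : Emits w inp (emitUpdate A) (InsertInv A w' H G' ops) := by
  rintro a v τ l t ha ⟨hl, G, hs, hG⟩
  have hg := hl _ List.mem_cons_self
  obtain ⟨τ', T₁, T₂, hT, hr, hs'⟩ := serves_update hg.tail hg.head (by simp) hs
  exact ⟨τ', T₁, T₂, hT, (runs_emitUpdate ha (hr.mono hw)).mono (by omega),
    fun e he => hl e (List.mem_cons_of_mem _ he), _, hs', hG⟩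

/-! ### Arcs as starting edges -/

/-- Append an arc to the starting edges. -/
def emitStore (a : ArcExpr) : Prog :=
  .seq (storeGuest 0 3 a.tail) (.seq (storeGuest 1 3 a.head) (.seq (storeGuest 2 3 a.cap)
    (.seq (.const 1 1) (.bin .add (3 * 3 + 2) (3 * 3 + 2) 1))))

theorem runs_increment {r : ℕ} (hw : 1 ≤ w) (hr : τ.reg r + 1 < 2 ^ w) :
    Runs w inp (.seq (.const 1 1) (.bin .add (3 * r + 2) (3 * r + 2) 1)) v τ v
      (τ.setReg r (τ.reg r + 1)) 2 := by
  intro σ hσ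
  have h2 : 1 < 2 ^ w := Nat.one_lt_two_pow (by omega)
  have hσ' := hσ.setTmp 0 1
  have e : BinOp.add.eval ((σ.setReg 1 1).reg (3 * r + 2)) ((σ.setReg 1 1).reg 1) =
      τ.reg r + 1 := by
    rw [← hσ'.reg]
    simp [BinOp.eval, State.setReg]
  refine ⟨_, _, .seq (.const _ _ _ h2) (.bin _ _ _ _ _ ?_), le_rfl, ?_⟩
  · rw [e]; exact hr
  · rw [e]; exact hσ'.setGuest _ _

theorem getD_map_append_singleton {X : Type*} (f : X → ℕ) (L : List X) (e : X) :
    (fun i => ((L ++ [e]).map f).getD i 0) =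
      Function.update (fun i => (L.map f).getD i 0) L.length (f e) := by
  funext i
  rcases lt_trichotomy i L.length with h | h | h
  · rw [Function.update_of_ne h.ne, List.map_append, List.getD_append _ _ _ _ (by simpa using h)]
  · subst h
    rw [Function.update_self, List.map_append, List.getD_append_right _ _ _ _ (by simp)]
    simp
  · rw [Function.update_of_ne h.ne', List.getD_eq_default _ _ (by simp; omega),
      List.getD_eq_default _ _ (by simp; omega)]

/-- Cells beyond the end of a list read as `0`, so appending an edge amounts to one write in each of
three arrays and an increment of the edge counter. -/
theorem startState_append {H : Net} {L : List Arc} {e : Arc} {ops : List (Op H.nodes)}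
    (h1 : e.1 < H.nodes) (h2 : e.2.1 < H.nodes) :
    ((((((H.mkInstance L ops).startState).setMem 0 L.length e.1).setMem 1 L.length e.2.1).setMem 2
      L.length e.2.2).setReg 3 (L.length + 1)) = (H.mkInstance (L ++ [e]) ops).startState := by
  have key : ∀ f : Fin H.nodes × Fin H.nodes × ℕ → ℕ,
      (fun i => ((((L ++ [e]).map H.edge)).map f).getD i 0) =
        Function.update (fun i => ((L.map H.edge).map f).getD i 0) L.length (f (H.edge e)) := by
    intro f
    simp only [List.map_map]
    exact getD_map_append_singleton (f ∘ H.edge) L e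
  have k0 := key fun e => e.1.val
  have k1 := key fun e => e.2.1.val
  have k2 := key fun e => e.2.2
  simp only [Net.edge, Net.node_val h1, Net.node_val h2] at k0 k1 k2
  simp only [State.setReg, State.setMem, Instance.startState, Net.mkInstance, State.mk.injEq]
  constructor
  · funext r
    by_cases hr : r = 3
    · subst hr; simp
    · rw [Function.update_of_ne hr]
      simp [hr]
  · funext M i
    by_cases hM2 : M = 2
    · subst hM2
      simp only [Function.update_self]
      exact (congrFun k2 i).symm
    by_cases hM1 : M = 1
    · subst hM1
      simp only [Function.update_self, ne_eq, hM2, not_false_eq_true, Function.update_of_ne]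
      exact (congrFun k1 i).symm
    by_cases hM0 : M = 0
    · subst hM0
      simp only [Function.update_self, ne_eq, hM1, hM2, not_false_eq_true, Function.update_of_ne]
      exact (congrFun k0 i).symm
    simp [hM0, hM1, hM2]

/-- The starting edges that are still missing are those of the list. -/
def StoreInv (H : Net) (L₀ : List Arc) (ops : List (Op H.nodes)) (l : List Arc) (τ : State)
    (_t : ℕ) : Prop :=
  (∀ e ∈ l, H.Good e) ∧ ∃ L, τ = (H.mkInstance L ops).startState ∧ L ++ l = L₀

/-- Storing is work of the host alone and takes nothing from the supply. The bound on `L₀` keeps the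
edge counter of the guest within a word. -/
theorem emits_emitStore {H : Net} {L₀ : List Arc} (hw : 1 ≤ w) (hL₀ : L₀.length < 2 ^ w)
    {ops : List (Op H.nodes)} : Emits w inp emitStore (StoreInv H L₀ ops) := by
  rintro a v _ l t ha ⟨hl, L, rfl, hL⟩
  have hg := hl _ List.mem_cons_self
  set τ := (H.mkInstance L ops).startState with hτ
  have h3 : τ.reg 3 = L.length := by simp [hτ, Instance.startState, Net.mkInstance]
  have hlen : L.length + 1 < 2 ^ w := by
    refine lt_of_le_of_lt ?_ hL₀
    rw [← hL, List.length_append, List.length_cons]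
    omega
  have r := (runs_storeGuest (τ := τ) 0 3 ha.1).seq ((runs_storeGuest 1 3 ha.2.1).seq
    ((runs_storeGuest 2 3 ha.2.2).seq (runs_increment (r := 3) hw
      (by simpa only [State.setMem, h3] using hlen))))
  simp only [State.setMem, h3] at r
  have hs := startState_append (ops := ops) (L := L) hg.tail hg.head
  simp only [State.setMem, ← hτ] at hs
  refine ⟨_, 0, t, zero_add t, r.mono ?_, fun e he => hl e (List.mem_cons_of_mem _ he),
    L ++ [a.eval inp v], hs, ?_⟩
  · simp only [ArcExpr.cost]
    omega
  · rw [← hL]; simp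

/-! ### The phases -/

/-- The expressions for the first update of a phase. -/
def firstExpr : Mode → ArcExpr
  | .incremental => .sa (.var 2)
  | .decremental => .at' (.num 0)

/-- The expressions for the second update of a phase. -/
def secondExpr : Mode → ArcExpr
  | .incremental => .at' (.var 2)
  | .decremental => .sa (.num 0)

/-- The capacity of the edges at the source at a query. -/
def fullExpr : Mode → Expr
  | .incremental => .bin .mul (.var 2) (.bin .sub (.var 2) (.var 4))
  | .decremental => .bin .mul (.var 2) (.bin .add (.var 4) (.num 1))

/-- One phase: the variable `5` records whether an answer was smaller than the capacity of the
edges at the source. -/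
def phaseBody (A : Algorithm) (mode : Mode) : Prog :=
  .seq (emitUpdate A (firstExpr mode)) (.seq A.query.embed
    (.seq (orGuestLt 5 0 (fullExpr mode)) (emitUpdate A (secondExpr mode))))

section Phase

open SAT

variable {n h : ℕ} {φ : CNF n} {mode : Mode}

theorem eval_firstExpr (hv : Env h φ v) :
    (firstExpr mode).eval inp v = (net k h φ).firstArc mode (v 4) := by
  cases mode
  · simp only [ArcExpr.eval, firstExpr, ArcExpr.sa, Expr.eval, BinOp.eval, hv.elts]
    rfl
  · rfl

theorem eval_secondExpr (hv : Env h φ v) :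
    (secondExpr mode).eval inp v = (net k h φ).secondArc mode (v 4) := by
  cases mode
  · simp only [ArcExpr.eval, secondExpr, ArcExpr.at', Expr.eval, BinOp.eval, hv.elts]
    rfl
  · rfl

/-- This is `N` times the number of source arcs at the query: the elements from `v 4` on in the
incremental mode, those up to `v 4` in the decremental one. The hypothesis `h4` controls the
truncated subtraction. -/
theorem eval_fullExpr (hv : Env h φ v) (h4 : v 4 < 2 ^ h) :
    (fullExpr mode).eval inp v =
      (net k h φ).N * (((net k h φ).others mode (v 4)).card + 1) := by
  cases mode
  · simp only [fullExpr, Expr.eval, BinOp.eval, hv.elts, Net.others, Nat.card_Ico]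
    simp only [net]
    congr 1
    omega
  · simp only [fullExpr, Expr.eval, BinOp.eval, hv.elts, Net.others, Finset.card_range]
    rfl

theorem fits_firstExpr (hW : Wide k W w inp) (hv : ∀ r, v r < 2 ^ W) :
    (firstExpr mode).Fits w inp v := by
  refine hW.fitsArc hv ?_ ?_ <;> cases mode <;>
    simp [firstExpr, ArcExpr.sa, ArcExpr.at', ArcExpr.NoShl, Expr.NoShl, ArcExpr.size, Expr.size,
      wordCost]

theorem fits_secondExpr (hW : Wide k W w inp) (hv : ∀ r, v r < 2 ^ W) :
    (secondExpr mode).Fits w inp v := by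
  refine hW.fitsArc hv ?_ ?_ <;> cases mode <;>
    simp [secondExpr, ArcExpr.sa, ArcExpr.at', ArcExpr.NoShl, Expr.NoShl, ArcExpr.size, Expr.size,
      wordCost]

theorem fits_fullExpr (hW : Wide k W w inp) (hv : ∀ r, v r < 2 ^ W) :
    (fullExpr mode).Fits w inp v := by
  refine hW.fits hv ?_ ?_ <;> cases mode <;>
    simp [fullExpr, Expr.NoShl, Expr.size, wordCost]

/-- The first half assignment `x` extends to a satisfying assignment. -/
def Extends (H : Net) (x : ℕ) : Prop := ∃ b < H.N, ∀ j < H.M, H.α x j = 1 ∨ H.β b j = 1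

theorem first_lt_nodes {H : Net} {i : ℕ} (hi : i < H.N) :
    (H.firstArc mode i).1 < H.nodes ∧ (H.firstArc mode i).2.1 < H.nodes ∧
      (H.secondArc mode i).1 < H.nodes ∧ (H.secondArc mode i).2.1 < H.nodes := by
  have := Net.le_nodes (H := H)
  cases mode <;> simp only [Net.firstArc, Net.secondArc] <;> omega

/-- Induction on the number of phases that are left, with the flag `f` left by the earlier ones kept
arbitrary. `Net.maxFlow_lt_iff` turns the comparison of each answer with the full capacity into
`Extends`. -/
theorem runs_phases {A : Algorithm} {w' : ℕ} (hw : w' ≤ w)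
    (hW : Wide k W w inp) (hv : ∀ r, v r < 2 ^ W)
    (hE : Env h φ v) {i : ℕ} (hi : i ≤ 2 ^ h) : ∀ {f t : ℕ} {τ : State}, f ≤ 1 →
    A.Serves w' (net k h φ).s (net k h φ).t ((net k h φ).graph ((net k h φ).linked mode i)) τ
      ((net k h φ).phaseOps mode i) t →
    ∃ τ' f', (f' = 1 ↔ f = 1 ∨ ∃ x < i, Extends (net k h φ) x) ∧ f' ≤ 1 ∧
      Runs w inp (countLoop (phaseBody A mode)) (Function.update (Function.update v 5 f) 4 i) τ
        (Function.update (Function.update v 5 f') 4 0) τ' (i * stepCost k + 1 + t) := by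
  classical
  have hN : 2 ^ h < 2 ^ W := hE.elts ▸ hv 2
  have h1W : 1 < 2 ^ W := Nat.one_lt_two_pow (by have := hW.pos; omega)
  induction i with
  | zero =>
    intro f t τ hf _
    refine ⟨τ, f, by simp, hf, (Runs.loop_done ?_).mono (by omega)⟩
    simp
  | succ i ih =>
    intro f t τ hf hs
    have hiN : i < (net k h φ).N := hi
    obtain ⟨b1, b2, b3, b4⟩ := first_lt_nodes (mode := mode) hiN
    have hv1 : ∀ g ≤ 1, ∀ r, Function.update (Function.update v 5 g) 4 i r < 2 ^ W := fun g hg =>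
      update_lt (update_lt hv (by omega)) (by omega)
    have hE1 : ∀ g, Env h φ (Function.update (Function.update v 5 g) 4 i) := fun g =>
      (hE.update (by norm_num) g).update le_rfl i
    obtain ⟨τ₁, T₁, T₂, hT, x₁, hs⟩ := serves_update b1 b2 (by rintro rfl; rfl) hs
    rw [Net.apply_firstArc hiN] at hs
    cases hs with
    | @query _ _ τ₂ _ T₃ T₄ hrun hans hrest =>
    obtain ⟨τ₃, T₅, T₆, hT', x₃, hs⟩ := serves_update b3 b4 (by rintro rfl; rfl) hrest
    rw [Net.apply_secondArc hiN] at hs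
    have hlt := Net.maxFlow_lt_iff hiN Net.notMem_others
      (fun x hx => Net.lt_of_mem_others hiN hx) hans
    set g : ℕ := f ||| if Extends (net k h φ) i then 1 else 0 with hg
    have hg1 : g ≤ 1 ∧ (g = 1 ↔ f = 1 ∨ Extends (net k h φ) i) := by
      rw [hg]
      rcases Nat.le_one_iff_eq_zero_or_eq_one.1 hf with h0 | h0 <;> rw [h0] <;>
        split_ifs with h1 <;> simp [h1]
    obtain ⟨τ₄, f', hf', hf'1, r₄⟩ := ih (by omega) hg1.1 hs
    have r₁ := runs_emitUpdate (w := w) (inp := inp) (A := A) (τ := τ)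
      (fits_firstExpr (mode := mode) hW (hv1 f hf))
      (by rw [eval_firstExpr (k := k) (hE1 f), Function.update_self]; exact x₁.mono hw)
    have r₂ : Runs w inp A.query.embed (Function.update (Function.update v 5 f) 4 i) τ₁
      (Function.update (Function.update v 5 f) 4 i) τ₂ T₃ := Runs.embed (hrun.mono hw)
    have r₃ := runs_orGuestLt (τ := τ₂) 5 0 (fits_fullExpr (mode := mode) hW (hv1 f hf)) hW.one_le
      (hW.lt (hv1 f hf 5))
    rw [eval_fullExpr (k := k) (hE1 f) (by rw [Function.update_self]; exact hi),
      Function.update_self] at r₃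
    have hval : Function.update (Function.update (Function.update v 5 f) 4 i) 5
        (Function.update (Function.update v 5 f) 4 i 5 |||
          if τ₂.reg 0 < (net k h φ).N * (((net k h φ).others mode i).card + 1) then 1 else 0) =
        Function.update (Function.update v 5 g) 4 i := by
      have e : (if τ₂.reg 0 < (net k h φ).N * (((net k h φ).others mode i).card + 1)
          then 1 else 0) = if Extends (net k h φ) i then 1 else 0 :=
        if_congr hlt rfl rfl
      rw [e, Function.update_comm (by norm_num), Function.update_idem]
      simp [hg]
    rw [hval] at r₃
    have r₅ := runs_emitUpdate (w := w) (inp := inp) (A := A) (τ := τ₂)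
      (fits_secondExpr (mode := mode) hW (hv1 g hg1.1))
      (by rw [eval_secondExpr (k := k) (hE1 g), Function.update_self]; exact x₃.mono hw)
    refine ⟨τ₄, f', ?_, hf'1, ?_⟩
    · rw [hf', hg1.2, Nat.exists_lt_succ_right, or_assoc]
      refine or_congr Iff.rfl or_comm
    · refine (Runs.loop_step (by simp) ((runs_decrement hW.one_le
        (hW.lt (by omega))).seq (r₁.seq (r₂.seq (r₃.seq r₅)))) r₄).mono ?_
      have c1 : (firstExpr mode).cost ≤ 6 := by
        cases mode <;> simp [firstExpr, ArcExpr.cost, ArcExpr.sa, ArcExpr.at', Expr.cost]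
      have c2 : (secondExpr mode).cost ≤ 6 := by
        cases mode <;> simp [secondExpr, ArcExpr.cost, ArcExpr.sa, ArcExpr.at', Expr.cost]
      have c3 : (fullExpr mode).cost ≤ 6 := by
        cases mode <;> simp [fullExpr, Expr.cost]
      have c4 : 60 ≤ stepCost k := by simp only [stepCost]; omega
      rw [add_mul, one_mul]
      omega

end Phase

end WordRAM

/-! ### The complete program for satisfiability. -/

namespace WordRAM

open DynFlow SAT

/-- Bring the dynamic algorithm into the state before the phases. -/
def prepare (A : Algorithm) (k : ℕ) : Mode → Prog
  | .incremental => .seq A.setup.embed (baseProg (emitUpdate A) k)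
  | .decremental => .seq (allProg emitStore k) A.setup.embed

/-- The number of nodes of the network. -/
def nodesExpr : Expr :=
  .bin .add (.bin .mul (.bin .mul (.num 3) (.var 2)) (.bin .add (.var 1) (.num 1))) (.num 2)

/-- The program for satisfiability that uses an algorithm for dynamic flow. -/
def satProg (A : Algorithm) (mode : Mode) (k : ℕ) : Prog :=
  .seq (.bin .or (3 * 1) 1 1)
  (.seq (assign 3 (.bin .div (.bin .add (.var 0) (.num 1)) (.num 2)))
  (.seq (assign 2 (.bin .shl (.num 1) (.var 3)))
  (.seq (setGuest 0 nodesExpr)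
  (.seq (setGuest 2 (.num 1))
  (.seq (prepare A k mode)
  (.seq (assign 4 (.var 2))
  (.seq (countLoop (phaseBody A mode))
    (assign 0 (.var 5)))))))))

variable {n k h W w w' : ℕ} {φ : CNF n} {mode : Mode} {A : Algorithm} {v : ℕ → ℕ}

/-- The modes differ in whether the base arcs are insertions, paid from `T₁`, or part of the input,
written before `setup`. Afterwards both have the graph with which the phases begin. -/
theorem runs_prepare (hw : w' ≤ w) (hW : Wide k W w ((inputState k φ).mem 0))
    (hv : ∀ r, v r < 2 ^ W) (hE : Env h φ v) (hNM : 2 ^ h * φ.length < 2 ^ W)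
    (hlen : (net k h φ).allArcs.length < 2 ^ w) {σ : State} {T₀ T₁ : ℕ}
    (hsetup : Exec w' A.setup ((net k h φ).inst mode).startState σ T₀)
    (hserves : A.Serves w' (net k h φ).s (net k h φ).t ((net k h φ).inst mode).startGraph σ
      ((net k h φ).allOps mode) T₁) :
    ∃ τ' t₁ t₂, t₁ + t₂ = T₀ + T₁ ∧ Runs w ((inputState k φ).mem 0) (prepare A k mode) v
      ((net k h φ).mkInstance [] []).startState (Function.update v 4 0) τ'
      ((2 ^ h * φ.length + 2 * 2 ^ h + 2) * stepCost k + t₁) ∧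
      A.Serves w' (net k h φ).s (net k h φ).t
        ((net k h φ).graph ((net k h φ).linked mode (net k h φ).N)) τ'
        ((net k h φ).phaseOps mode (net k h φ).N) t₂ := by
  rw [Net.startGraph_inst] at hserves
  cases mode with
  | incremental =>
    have hI : InsertInv A w' (net k h φ)
        ((net k h φ).graph ((net k h φ).linked .incremental (net k h φ).N))
        ((net k h φ).phaseOps .incremental (net k h φ).N) ((net k h φ).baseArcs ++ []) σ T₁ := by
      rw [List.append_nil]
      exact ⟨fun _ => Net.good_of_mem_baseArcs, _, hserves, Net.foldl_insertArcs⟩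
    obtain ⟨τ', t₁, t₂, ht, hr, -, G, hs, hG⟩ := (emits_emitUpdate hw).base hW hv hE hNM hI
    refine ⟨τ', T₀ + t₁, t₂, by omega, ((Runs.embed (hsetup.mono hw)).seq hr).mono ?_, ?_⟩
    · simp only [add_mul, mul_assoc]
      omega
    · rw [← hG]
      exact hs
  | decremental =>
    have hI : StoreInv (net k h φ) (net k h φ).allArcs [] (net k h φ).allArcs
        ((net k h φ).mkInstance [] []).startState 0 :=
      ⟨fun _ => Net.good_of_mem_allArcs, [], rfl, rfl⟩
    obtain ⟨τ', t₁, t₂, ht, hr, -, L, rfl, hL⟩ :=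
      (emits_emitStore hW.one_le hlen).allArcs hW hv hE hNM hI
    rw [List.append_nil] at hL
    subst hL
    refine ⟨σ, T₀, T₁, rfl, (hr.seq (Runs.embed (hsetup.mono hw))).mono (by omega), ?_⟩
    have hG := Net.foldl_insertArcs (H := net k h φ) (mode := .decremental)
    rw [← hG]
    exact hserves

/-- Register `1`, which holds the number of clauses, is a temporary of the host and thus invisible
to `Rep`. For this reason the first instruction of `satProg` copies it to variable `1`. -/
theorem rep_input (k : ℕ) (φ : CNF n) :
    Rep ((inputState k φ).mem 0) (Function.update (fun _ => 0) 0 n) ⟨fun _ => 0, fun _ _ => 0⟩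
      (inputState k φ) where
  var r := by
    by_cases hr : r = 0
    · simp [inputState, hr]
    · simp only [inputState, ne_eq, hr, not_false_eq_true, Function.update_of_ne]
      rw [if_neg (by omega), if_neg (by omega)]
  reg r := by
    simp only [inputState]
    rw [if_neg (by omega), if_neg (by omega)]
  inp := rfl
  mem M := by
    funext i
    simp [inputState]

theorem runs_satProg (hk : 0 < k) (hφ : IsKCNF k φ) (hw : w' ≤ w) (hh : h = (n + 1) / 2)
    (hW : Wide k W w ((inputState k φ).mem 0)) (hnW : n < 2 ^ W) (hMW : φ.length < 2 ^ W)
    (hNW : 2 ^ h < 2 ^ W) (hNM : 2 ^ h * φ.length < 2 ^ W)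
    (hlen : (net k h φ).allArcs.length < 2 ^ w) {σ : State} {T₀ T₁ : ℕ}
    (hsetup : Exec w' A.setup ((net k h φ).inst mode).startState σ T₀)
    (hserves : A.Serves w' (net k h φ).s (net k h φ).t ((net k h φ).inst mode).startGraph σ
      ((net k h φ).allOps mode) T₁) :
    ∃ σ' T, Exec w (satProg A mode k) (inputState k φ) σ' T ∧
      (σ'.reg 0 = 1 ↔ Satisfiable φ) ∧
      T ≤ 6 * stepCost k * (2 ^ h * (φ.length + 1)) + (T₀ + T₁) := by
  have h0 : 0 < 2 ^ W := by positivity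
  have hhW : h < 2 ^ W := by omega
  let v₀ : ℕ → ℕ := Function.update (fun _ => 0) 0 n
  let v₁ := Function.update v₀ 1 φ.length
  let v₂ := Function.update v₁ 3 h
  let v₃ := Function.update v₂ 2 (2 ^ h)
  have hv₁ : ∀ r, v₁ r < 2 ^ W := update_lt (update_lt (fun _ => h0) hnW) hMW
  have hv₂ : ∀ r, v₂ r < 2 ^ W := update_lt hv₁ hhW
  have hv₃ : ∀ r, v₃ r < 2 ^ W := update_lt hv₂ hNW
  have hE : Env h φ v₃ := ⟨by simp [v₃, v₂, v₁], by simp [v₃], by simp [v₃, v₂]⟩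
  let inp := (inputState k φ).mem 0
  let τ₀ : State := ⟨fun _ => 0, fun _ _ => 0⟩
  have r₁ : Runs w inp (assign 3 (.bin .div (.bin .add (.var 0) (.num 1)) (.num 2))) v₁ τ₀
      v₂ τ₀ 6 := by
    have := runs_assign (τ := τ₀) (e := .bin .div (.bin .add (.var 0) (.num 1)) (.num 2)) 3
      (hW.fits hv₁ (by simp [Expr.NoShl]) (by simp [Expr.size, wordCost]))
    simpa [Expr.eval, BinOp.eval, Expr.cost, v₂, v₁, v₀, hh] using this
  have r₂ : Runs w inp (assign 2 (.bin .shl (.num 1) (.var 3))) v₂ τ₀ v₃ τ₀ 4 := by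
    -- This is the only left shift, so `Wide.fits` does not apply; `hNW` bounds its value `2 ^ h`
    -- directly.
    have hfit : (Expr.bin .shl (.num 1) (.var 3)).Fits w inp v₂ := by
      refine ⟨?_, hW.lt (hv₂ 3), ?_⟩
      · exact Nat.one_lt_two_pow (by have := hW.one_le; omega)
      · simpa [Expr.eval, BinOp.eval, v₂, Nat.shiftLeft_eq] using hW.lt hNW
    have := runs_assign (τ := τ₀) 2 hfit
    simpa [Expr.eval, BinOp.eval, Expr.cost, v₂, v₃, Nat.shiftLeft_eq] using this
  have r₃ : Runs w inp (.seq (setGuest 0 nodesExpr) (setGuest 2 (.num 1))) v₃ τ₀ v₃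
      ((net k h φ).mkInstance [] []).startState 12 := by
    have e₁ := runs_setGuest (τ := τ₀) (e := nodesExpr) 0
      (hW.fits hv₃ (by simp [nodesExpr, Expr.NoShl]) (by simp [nodesExpr, Expr.size, wordCost]))
    have e₂ := runs_setGuest (τ := τ₀.setReg 0 (nodesExpr.eval inp v₃)) (e := .num 1) 2
      (hW.fits hv₃ (by simp [Expr.NoShl]) (by simp [Expr.size, wordCost]))
    -- The source has number `0` and there are no edges yet, so only the number of nodes and the
    -- sink have to be written.
    have hst : (τ₀.setReg 0 (nodesExpr.eval inp v₃)).setReg 2 ((Expr.num 1).eval inp v₃) =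
        ((net k h φ).mkInstance [] []).startState := by
      have hn : nodesExpr.eval inp v₃ = (net k h φ).nodes := by
        simp only [nodesExpr, Expr.eval, BinOp.eval, hE.elts, hE.clauses]
        rfl
      rw [hn]
      simp only [State.setReg, Instance.startState, State.mk.injEq]
      constructor
      · funext r
        by_cases hr2 : r = 2
        · subst hr2; simp [Expr.eval, Net.mkInstance, Net.t]
        by_cases hr0 : r = 0
        · subst hr0; simp [Net.mkInstance]
        · simp [hr0, hr2, τ₀, Net.mkInstance, Net.s]
      · funext M i
        simp [τ₀, Net.mkInstance]
    have e := e₁.seq e₂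
    rw [hst] at e
    exact e.mono (by simp [nodesExpr, Expr.cost])
  obtain ⟨τ₄, t₁, t₂, ht, r₄, hs⟩ := runs_prepare hw hW hv₃ hE hNM hlen hsetup hserves
  have r₅ : Runs w inp (assign 4 (.var 2)) (Function.update v₃ 4 0) τ₄
      (Function.update v₃ 4 (2 ^ h)) τ₄ 2 := by
    have := runs_assign (τ := τ₄) (e := .var 2) 4
      (hW.fits (update_lt (r := 4) hv₃ h0) (by simp [Expr.NoShl]) (by simp [Expr.size, wordCost]))
    simpa [Expr.eval, Expr.cost, v₃] using this
  obtain ⟨τ₆, f, hf, hf1, r₆⟩ := runs_phases (f := 0) hw hW hv₃ hE (i := 2 ^ h) le_rfl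
    (by norm_num) hs
  rw [show Function.update v₃ 5 0 = v₃ from
    Function.update_eq_self_iff.2 (by simp [v₃, v₂, v₁, v₀])] at r₆
  have h1W : 1 < 2 ^ W := Nat.one_lt_two_pow (by have := hW.pos; omega)
  have r₇ := runs_assign (τ := τ₆) (e := .var 5) 0
    (hW.fits (update_lt (r := 4) (update_lt (r := 5) (x := f) hv₃ (by omega)) h0)
      (by simp [Expr.NoShl]) (by simp [Expr.size, wordCost]))
  -- `r₃` treats the two writes as one block, whereas `satProg` nests the second with the remaining
  -- program. Inverting the execution of the block reassociates the sequence.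
  have r₃₄ : ∀ q v' τ' T, Runs w inp q v₃ ((net k h φ).mkInstance [] []).startState v' τ' T →
      Runs w inp (.seq (setGuest 0 nodesExpr) (.seq (setGuest 2 (.num 1)) q)) v₃ τ₀ v' τ'
        (12 + T) := by
    intro q v' τ' T hq σ hσ
    obtain ⟨σ₁, S₁, x₁, y₁, z₁⟩ := r₃ σ hσ
    obtain ⟨σ₂, S₂, x₂, y₂, z₂⟩ := hq σ₁ z₁
    cases x₁ with
    | @seq _ _ _ σ₃ _ S₃ S₄ hp hp' =>
      exact ⟨σ₂, S₃ + (S₄ + S₂), .seq hp (.seq hp' x₂), by omega, z₂⟩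
  have hrun := r₁.seq (r₂.seq (r₃₄ _ _ _ _ (r₄.seq (r₅.seq (r₆.seq r₇)))))
  have hin := rep_input k φ
  have hM : BinOp.or.eval ((inputState k φ).reg 1) ((inputState k φ).reg 1) = φ.length := by
    simp [BinOp.eval, inputState]
  obtain ⟨σ', S, x, y, z⟩ := hrun _ (hin.setVar 1 φ.length)
  refine ⟨σ', 1 + S, .seq ?_ x, ?_, ?_⟩
  · have := Exec.bin (w := w) (inputState k φ) .or (3 * 1) 1 1 (by rw [hM]; exact hW.lt hMW)
    rwa [hM] at this
  · have hz := z.var 0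
    simp only [mul_zero, Expr.eval, Function.update_self] at hz
    rw [hz]
    simp only [ne_eq, Nat.reduceEqDiff, not_false_eq_true, Function.update_of_ne,
      Function.update_self]
    rw [hf, satisfiable_iff hk hφ (h := h) (by omega)]
    simp only [Nat.zero_ne_one, false_or]
    rfl
  · have c4 : 60 ≤ stepCost k := by simp only [stepCost]; omega
    have hN : 1 ≤ 2 ^ h := Nat.one_le_two_pow
    have hb : 2 ^ h * φ.length + 3 * 2 ^ h + 3 ≤ 6 * (2 ^ h * (φ.length + 1)) := by
      rw [mul_add]; omega
    have := Nat.mul_le_mul_right (stepCost k) hb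
    have h5 : (Expr.var 5).cost = 1 := rfl
    rw [h5] at y
    rw [show 6 * stepCost k * (2 ^ h * (φ.length + 1)) =
      6 * (2 ^ h * (φ.length + 1)) * stepCost k by ring]
    simp only [add_mul] at *
    simp only [mul_assoc] at *
    omega

end WordRAM

/-! ### Word lengths, running times and the contradiction with SETH. -/

namespace SAT

open WordRAM DynFlow

theorem lt_two_pow_log (M : ℕ) : M + 1 < 2 ^ (Nat.log 2 (M + 1) + 1) :=
  Nat.lt_pow_succ_log_self (by norm_num) _

theorem elts_mul_clauses_lt (n M : ℕ) :
    2 ^ ((n + 1) / 2) * (M + 1) < 2 ^ (n + Nat.log 2 (M + 1) + 1) := by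
  have h1 : 2 ^ ((n + 1) / 2) ≤ 2 ^ n := Nat.pow_le_pow_right (by norm_num) (by omega)
  calc 2 ^ ((n + 1) / 2) * (M + 1) ≤ 2 ^ n * (M + 1) := Nat.mul_le_mul_right _ h1
    _ < 2 ^ n * 2 ^ (Nat.log 2 (M + 1) + 1) :=
        Nat.mul_lt_mul_of_pos_left (lt_two_pow_log M) (by positivity)
    _ = _ := by rw [← pow_add, add_assoc]

theorem log_size_le {n k : ℕ} {φ : CNF n} {mode : Mode} :
    Nat.log 2 ((net k ((n + 1) / 2) φ).inst mode).size + 1 ≤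
      8 * (n + Nat.log 2 (φ.length + 1) + 1) := by
  set L := n + Nat.log 2 (φ.length + 1) + 1 with hL
  have h1 : 2 ^ ((n + 1) / 2) * (φ.length + 1) < 2 ^ L := elts_mul_clauses_lt n φ.length
  have h2 : 2 ^ ((n + 1) / 2) ≤ 2 ^ L := Nat.pow_le_pow_right (by norm_num) (by omega)
  -- The constant `24` of `Net.size_inst_le` is below `2 ^ 5`, and `5 + 2 L + 1 ≤ 8 L` because `1 ≤
  -- L`.
  have h3 : ((net k ((n + 1) / 2) φ).inst mode).size ≤ 2 ^ (5 + L + L) := by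
    refine Net.size_inst_le.trans ?_
    rw [pow_add, pow_add, mul_assoc (2 ^ 5)]
    exact Nat.mul_le_mul (by norm_num) (Nat.mul_le_mul h1.le h2)
  have h4 := Nat.log_mono_right (b := 2) h3
  rw [Nat.log_pow (by norm_num)] at h4
  omega

theorem wide_words {n k c : ℕ} (φ : CNF n) :
    Wide k (n + Nat.log 2 (φ.length + 1) + 1)
      ((wordCost k + c) * (n + Nat.log 2 (φ.length + 1) + 1)) ((inputState k φ).mem 0) where
  pos := by omega
  le := Nat.mul_le_mul_right _ (by omega)
  inp x := by
    refine (input_mem_le k φ x).trans_lt ?_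
    have h1 : n < 2 ^ n := Nat.lt_two_pow_self
    have h2 : 2 ^ (n + 1) ≤ 2 ^ (n + Nat.log 2 (φ.length + 1) + 1) :=
      Nat.pow_le_pow_right (by norm_num) (by omega)
    rw [pow_succ] at h2
    omega

/-- `N (M + 1)` operations on `O(N (M + 1))` edges with `N ≤ 2 ^ ((n + 1) / 2)` are fast enough. -/
theorem elts_rpow_le {ε : ℝ} (hε : 0 < ε) (hε1 : ε ≤ 1) (n : ℕ) :
    ((2 ^ ((n + 1) / 2) : ℕ) : ℝ) * ((2 ^ ((n + 1) / 2) : ℕ) : ℝ) ^ (1 - ε) ≤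
      2 * (2 : ℝ) ^ ((1 - ε / 2) * (n : ℝ)) := by
  set h := (n + 1) / 2 with hh
  -- Rounding `n / 2` up adds at most `(2 - ε) / 2 ≤ 1` to the exponent `(2 - ε) h`, hence the
  -- factor `2`.
  have h1 : ((h : ℕ) : ℝ) ≤ ((n : ℝ) + 1) / 2 := by
    have : 2 * h ≤ n + 1 := by omega
    have : (2 : ℝ) * h ≤ n + 1 := by exact_mod_cast this
    linarith
  have h2 : ((2 ^ h : ℕ) : ℝ) = (2 : ℝ) ^ (h : ℝ) := by
    rw [Real.rpow_natCast]; push_cast; rfl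
  rw [h2, ← Real.rpow_mul (by norm_num), ← Real.rpow_add (by norm_num)]
  have h3 : (2 : ℝ) * (2 : ℝ) ^ ((1 - ε / 2) * (n : ℝ)) = 2 ^ (1 + (1 - ε / 2) * (n : ℝ)) := by
    rw [Real.rpow_add (by norm_num), Real.rpow_one]
  rw [h3]
  refine Real.rpow_le_rpow_of_exponent_le (by norm_num) ?_
  nlinarith

/-- The number of operations contributes `N (M + 1)` and the time per operation `(N (M + 1)) ^ (1 -
ε)`, up to constants. Only the power of `N` is kept sharp; the powers of `M + 1` are rounded up to a
square. -/
theorem flow_time_le {n k : ℕ} {φ : CNF n} {mode : Mode} {ε C : ℝ} (hε : 0 < ε) :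
    C * ((((net k ((n + 1) / 2) φ).inst mode).n : ℝ) +
        (((net k ((n + 1) / 2) φ).inst mode).edges.length : ℝ) +
        (((net k ((n + 1) / 2) φ).inst mode).ops.length : ℝ)) *
      ((((net k ((n + 1) / 2) φ).inst mode).m : ℝ) + 1) ^ (1 - ε) ≤
    96 * max C 0 * (2 : ℝ) ^ ((1 - min ε 1 / 2) * (n : ℝ)) * ((n : ℝ) + φ.length + 1) ^ 2 := by
  set H := net k ((n + 1) / 2) φ
  -- For `ε > 1` the exponent `1 - ε` is negative and cannot be used with an upper bound on `m`.
  -- Capping `ε` at `1` only weakens the assumed bound, since `m + 1 ≥ 1`.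
  set ε' := min ε 1 with hε'
  have hε'0 : 0 < ε' := lt_min hε one_pos
  have hε'1 : ε' ≤ 1 := min_le_right _ _
  set N : ℝ := ((2 ^ ((n + 1) / 2) : ℕ) : ℝ) with hN
  set M : ℝ := (φ.length : ℝ) with hM
  have hM0 : 0 ≤ M := Nat.cast_nonneg _
  have hN1 : 1 ≤ N := by rw [hN]; exact_mod_cast Nat.one_le_two_pow
  have hNM : ((H.N * (H.M + 1) : ℕ) : ℝ) = N * (M + 1) := by
    push_cast [hN, hM]; simp [H, net]
  have hsum : ((H.inst mode).n : ℝ) + ((H.inst mode).edges.length : ℝ) +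
      ((H.inst mode).ops.length : ℝ) ≤ 12 * (N * (M + 1)) := by
    have h1 := Net.length_edges_inst_le (H := H) (mode := mode)
    have h2 := Net.length_ops_inst_le (H := H) (mode := mode)
    have h3 : (H.inst mode).n ≤ 5 * (H.N * (H.M + 1)) := Net.nodes_le
    have : (H.inst mode).n + (H.inst mode).edges.length + (H.inst mode).ops.length ≤
      12 * (H.N * (H.M + 1)) := by omega
    rw [← hNM]
    exact_mod_cast this
  have hm : ((H.inst mode).m : ℝ) + 1 ≤ 4 * (M + 1) * N := by
    have h1 := Net.m_inst_le (H := H) (mode := mode)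
    have hpos := H.hN
    have : (H.inst mode).m + 1 ≤ 4 * (H.N * (H.M + 1)) := by rw [mul_add]; omega
    have h2 : ((H.inst mode).m : ℝ) + 1 ≤ 4 * ((H.N * (H.M + 1) : ℕ) : ℝ) := by
      exact_mod_cast this
    rw [hNM] at h2
    linarith
  have hm1 : (1 : ℝ) ≤ ((H.inst mode).m : ℝ) + 1 := by
    have : (0 : ℝ) ≤ ((H.inst mode).m : ℝ) := Nat.cast_nonneg _
    linarith
  have hpow : (((H.inst mode).m : ℝ) + 1) ^ (1 - ε) ≤ 4 * (M + 1) * N ^ (1 - ε') := by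
    calc (((H.inst mode).m : ℝ) + 1) ^ (1 - ε)
        ≤ (((H.inst mode).m : ℝ) + 1) ^ (1 - ε') :=
          Real.rpow_le_rpow_of_exponent_le hm1 (by have := min_le_left ε 1; linarith)
      _ ≤ (4 * (M + 1) * N) ^ (1 - ε') :=
          Real.rpow_le_rpow (by linarith) hm (by linarith)
      _ = (4 * (M + 1)) ^ (1 - ε') * N ^ (1 - ε') :=
          Real.mul_rpow (by linarith) (by linarith)
      _ ≤ (4 * (M + 1)) ^ (1 : ℝ) * N ^ (1 - ε') := by
          refine mul_le_mul_of_nonneg_right ?_ (Real.rpow_nonneg (by linarith) _)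
          exact Real.rpow_le_rpow_of_exponent_le (by linarith) (by linarith)
      _ = 4 * (M + 1) * N ^ (1 - ε') := by rw [Real.rpow_one]
  have hC : 0 ≤ max C 0 := le_max_right _ _
  have hp0 : 0 ≤ (((H.inst mode).m : ℝ) + 1) ^ (1 - ε) := Real.rpow_nonneg (by linarith) _
  have hexp := elts_rpow_le hε'0 hε'1 n
  rw [← hN] at hexp
  have hn0 : (0 : ℝ) ≤ n := Nat.cast_nonneg _
  have hM2 : (M + 1) ^ 2 ≤ ((n : ℝ) + M + 1) ^ 2 := pow_le_pow_left₀ (by linarith) (by linarith) 2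
  calc _ ≤ max C 0 * (12 * (N * (M + 1))) * (4 * (M + 1) * N ^ (1 - ε')) := by
        refine mul_le_mul ?_ hpow hp0 (by positivity)
        refine mul_le_mul (le_max_left _ _) hsum (by positivity) hC
    _ = 48 * max C 0 * ((N * N ^ (1 - ε')) * (M + 1) ^ 2) := by ring
    _ ≤ 48 * max C 0 * ((2 * (2 : ℝ) ^ ((1 - ε' / 2) * (n : ℝ))) * ((n : ℝ) + M + 1) ^ 2) := by
        refine mul_le_mul_of_nonneg_left ?_ (by positivity)
        exact mul_le_mul hexp hM2 (by positivity) (by positivity)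
    _ = _ := by ring

/-- The host's own work is proportional to `N (M + 1)`, which is within the target because `N ≤ N *
N ^ (1 - ε)`. -/
theorem overhead_le {ε : ℝ} (hε : 0 < ε) (hε1 : ε ≤ 1) (n M : ℕ) :
    ((2 ^ ((n + 1) / 2) * (M + 1) : ℕ) : ℝ) ≤
      2 * (2 : ℝ) ^ ((1 - ε / 2) * (n : ℝ)) * ((n : ℝ) + M + 1) ^ 2 := by
  have hM0 : (0 : ℝ) ≤ M := Nat.cast_nonneg _
  have hn0 : (0 : ℝ) ≤ n := Nat.cast_nonneg _
  have hN1 : (1 : ℝ) ≤ ((2 ^ ((n + 1) / 2) : ℕ) : ℝ) := by exact_mod_cast Nat.one_le_two_pow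
  have h1 : (1 : ℝ) ≤ ((2 ^ ((n + 1) / 2) : ℕ) : ℝ) ^ (1 - ε) :=
    Real.one_le_rpow hN1 (by linarith)
  have h2 := elts_rpow_le hε hε1 n
  have h3 : (M : ℝ) + 1 ≤ ((n : ℝ) + M + 1) ^ 2 := by nlinarith
  rw [Nat.cast_mul, Nat.cast_add, Nat.cast_one]
  refine mul_le_mul (le_trans ?_ h2) h3 (by linarith) (by positivity)
  exact le_mul_of_one_le_right (by linarith) h1

/-- A fast algorithm for partially dynamic flow gives a fast program for satisfiability. -/
theorem solvesKSAT_satProg {A : Algorithm} {mode : Mode} {K p k : ℕ} {ε : ℝ} (hK : 0 < K)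
    (hε : 0 < ε) (hk : 0 < k) (hA : A.Solves mode K p ε) :
    SolvesKSAT (satProg A mode k) k (min ε 1 / 2) := by
  obtain ⟨c, C, hA⟩ := hA
  -- The words have room for the expressions of the host (`wordCost k`) and for the words of the
  -- guest (`8 * c`, by `log_size_le`). The constant `12` is the `6` of `runs_satProg` times the `2`
  -- of `overhead_le`.
  refine ⟨wordCost k + 8 * c, 2, 12 * stepCost k + 96 * max C 0, fun n φ hφ => ?_⟩
  obtain ⟨σ, T₀, T₁, hsetup, hserves, hT⟩ :=
    hA ((net k ((n + 1) / 2) φ).inst mode) Net.valid_inst (Net.sparse_inst hK)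
  have hW := wide_words (k := k) (c := 8 * c) φ
  set L := n + Nat.log 2 (φ.length + 1) + 1 with hL
  have hNM : 2 ^ ((n + 1) / 2) * (φ.length + 1) < 2 ^ L := elts_mul_clauses_lt n φ.length
  have hword : c * (Nat.log 2 ((net k ((n + 1) / 2) φ).inst mode).size + 1) ≤
      (wordCost k + 8 * c) * L := by
    have := Nat.mul_le_mul_left c (log_size_le (k := k) (φ := φ) (mode := mode))
    rw [← hL, ← mul_assoc, mul_comm c 8] at this
    rw [add_mul]
    omega
  have hN1 : 1 ≤ 2 ^ ((n + 1) / 2) := Nat.one_le_two_pow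
  have hlen : (net k ((n + 1) / 2) φ).allArcs.length < 2 ^ ((wordCost k + 8 * c) * L) := by
    have h1 : (net k ((n + 1) / 2) φ).allArcs.length ≤
        3 * (2 ^ ((n + 1) / 2) * (φ.length + 1)) := by
      rw [Net.length_allArcs]
      simp only [net]
      rw [mul_add]
      omega
    have h2 : 2 ^ (2 + L) ≤ 2 ^ ((wordCost k + 8 * c) * L) := by
      refine Nat.pow_le_pow_right (by norm_num) ?_
      have h3 : 30 ≤ wordCost k + 8 * c := by simp only [wordCost]; omega
      have := Nat.mul_le_mul_right L h3
      omega
    rw [pow_add] at h2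
    omega
  obtain ⟨σ', T, hexec, hsat, hTle⟩ := runs_satProg hk hφ hword rfl hW
    (Nat.lt_two_pow_self.trans_le (Nat.pow_le_pow_right (by norm_num) (by omega)))
    (by nlinarith) (by nlinarith) (by nlinarith) hlen hsetup hserves
  refine ⟨σ', T, hexec, hsat, ?_⟩
  have h1 := hT.trans (flow_time_le hε)
  have h2 := overhead_le (lt_min hε one_pos) (min_le_right ε 1) n φ.length
  have h3 : (T : ℝ) ≤ 6 * stepCost k * ((2 ^ ((n + 1) / 2) * (φ.length + 1) : ℕ) : ℝ) +
      ((T₀ + T₁ : ℕ) : ℝ) := by exact_mod_cast hTle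
  have h4 := mul_le_mul_of_nonneg_left h2 (show (0 : ℝ) ≤ 6 * stepCost k by positivity)
  calc (T : ℝ) ≤ _ := h3
    _ ≤ _ := add_le_add h4 h1
    _ = _ := by ring

end SAT

theorem theorem2 (hSETH : SAT.SETH) (mode : DynFlow.Mode) (K p : ℕ) (hK : 0 < K)
    (ε : ℝ) (hε : 0 < ε) :
    ¬ ∃ A : DynFlow.Algorithm, A.Solves mode K p ε := by
  rintro ⟨A, hA⟩
  -- The saving depends on `ε` alone, so SETH fixes `k` first and the program may have `k` built in.
  obtain ⟨k, hk, hno⟩ := hSETH (min ε 1 / 2) (half_pos (lt_min hε one_pos))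
  exact hno ⟨_, SAT.solvesKSAT_satProg hK hε (by omega) hA⟩
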